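/- Let $\mathcal V$ be a complex Hilbert space with inner product $\langle\cdot,\cdot\rangle$, antilinear in the first argument. Let $\mathcal F_m(\mathcal V)$ be the $m$-fold Hilbert space tensor power of $\mathcal V$ (with $\mathcal F_0(\mathcal V)=\mathbb C$), $P_{+,m}=\frac1{m!}\sum_{\sigma\in S_m}\hat\sigma$ the symmetrization, and $\mathcal F^+(\mathcal V)=\overline{\bigoplus_{m\ge 0}P_{+,m}\mathcal F_m(\mathcal V)}$ the bosonic Fock space, with vacuum $|0\rangle=(1,0,0,\dots)$ and with the subspace $\mathcal F^{\mathrm{fin},+}(\mathcal V)$ of vectors $(\psi_0,\dots,\psi_N,0,0,\dots)$ having finitely many non-zero components. For $\xi\in\mathcal V$ put $c(\xi)\,\xi_1\otimes\dots\otimes\xi_m=\xi\otimes\xi_1\otimes\dots\otimes\xi_m$ and $d(\xi)\,\xi_1\otimes\dots\otimes\xi_m=\langle\xi,\xi_1\rangle\,\xi_2\otimes\dots\otimes\xi_m$ (with $d(\xi)=0$ on $\mathcal F_0$). On $\mathcal F^{\mathrm{fin},+}(\mathcal V)$ let $a^\dagger(\xi)=P_+\sqrt{N}\,c(\xi)P_+$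 and $a(\xi)=P_+\sqrt{N+1}\,d(\xi)P_+$, where $N$ is the number operator, $N\psi=(m\psi_m)_{m\ge0}$, and $P_+=\bigoplus_m P_{+,m}$. The Weyl operator is the unitary operator $W_{\mathrm F}(\xi)=e^{a^\dagger(\xi)-a(\xi)}$ on $\mathcal F^+(\mathcal V)$, that is, the continuous extension of $\psi\mapsto\sum_{k\ge0}\frac1{k!}(a^\dagger(\xi)-a(\xi))^k\psi$, $\psi\in\mathcal F^{\mathrm{fin},+}(\mathcal V)$. For a closed complex subspace $\mathcal U\subset\mathcal V$, $\mathcal F^+(\mathcal U)$ is regarded as a subspace of $\mathcal F^+(\mathcal V)$. **Theorem.** Let $\mathcal W$ be a real linear subspace of $\mathcal V$. For $\psi\in\mathcal F^+(\mathcal V)$ consider the condition $$\langle\psi|W_{\mathrm F}(\xi)|\psi\rangle=\langle 0|W_{\mathrm F}(\xi)|0\rangle\qquad\text{for all }\xi\in\mathcal W.\tag{$*$}$$ (i) Every $\psi\in\mathcal F^+\big((\overline{\mathrm{span}}_{\mathbb C}\mathcal W)^\perp\big)\subset\mathcal F^+(\mathcal V)$ with $\|\psi\|=1$ satisfies $(*)$.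 (ii) If $\mathrm{span}_{\mathbb C}\mathcal W$ is dense in $\mathcal V$, then the vacuum is, up to a phase, the only vector of $\mathcal F^{\mathrm{fin},+}(\mathcal V)$ satisfying $(*)$: a vector $\psi\in\mathcal F^{\mathrm{fin},+}(\mathcal V)$ satisfies $(*)$ if and only if $\psi=c\,|0\rangle$ for some $c\in\mathbb C$ with $|c|=1$. -/

import Mathlib

namespace FockSpace

section

variable (V : Type*) [NormedAddCommGroup V] [InnerProductSpace ℂ V]

/-- The algebraic `m`-fold tensor power of `V`. -/
def TensorPow (m : ℕ) : Type _ := PiTensorProduct ℂ (fun _ : Fin m => V)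

noncomputable instance (m : ℕ) : AddCommGroup (TensorPow V m) :=
  inferInstanceAs (AddCommGroup (PiTensorProduct ℂ (fun _ : Fin m => V)))

noncomputable instance (m : ℕ) : Module ℂ (TensorPow V m) :=
  inferInstanceAs (Module ℂ (PiTensorProduct ℂ (fun _ : Fin m => V)))

variable {V}

/-- The elementary tensor `ξ₁ ⊗ ⋯ ⊗ ξₘ`, as a multilinear function of `ξ`. -/
noncomputable def tmul (m : ℕ) : MultilinearMap ℂ (fun _ : Fin m => V) (TensorPow V m) :=
  PiTensorProduct.tprod ℂ

/-- The linear map on the tensor power given by a multilinear map. -/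
noncomputable def tlift {m : ℕ} {E : Type*} [AddCommMonoid E] [Module ℂ E]
    (f : MultilinearMap ℂ (fun _ : Fin m => V) E) : TensorPow V m →ₗ[ℂ] E :=
  PiTensorProduct.lift f

@[simp] theorem tlift_tmul {m : ℕ} {E : Type*} [AddCommMonoid E] [Module ℂ E]
    (f : MultilinearMap ℂ (fun _ : Fin m => V) E) (ξ : Fin m → V) :
    tlift f (tmul m ξ) = f ξ :=
  PiTensorProduct.lift.tprod ξ

theorem tensorPow_induction {m : ℕ} {p : TensorPow V m → Prop} (x : TensorPow V m)
    (h1 : ∀ (c : ℂ) (ξ : Fin m → V), p (c • tmul m ξ))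
    (h2 : ∀ x y, p x → p y → p (x + y)) : p x :=
  PiTensorProduct.induction_on x h1 h2

theorem span_tmul (m : ℕ) : Submodule.span ℂ (Set.range (tmul (V := V) m)) = ⊤ :=
  PiTensorProduct.span_tprod_eq_top

/-- The functional `η₁ ⊗ ⋯ ⊗ ηₘ ↦ ∏ᵢ ⟨ξᵢ, ηᵢ⟩`. -/
noncomputable def innerFunctional {m : ℕ} (ξ : Fin m → V) : TensorPow V m →ₗ[ℂ] ℂ :=
  tlift ((MultilinearMap.mkPiAlgebra ℂ (Fin m) ℂ).compLinearMap fun i => innerₛₗ ℂ (ξ i))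

@[simp] theorem innerFunctional_tmul {m : ℕ} (ξ η : Fin m → V) :
    innerFunctional ξ (tmul m η) = ∏ i, inner ℂ (ξ i) (η i) := by
  simp [innerFunctional]

theorem prod_inner_update {m : ℕ} [DecidableEq (Fin m)] (ξ η : Fin m → V) (i : Fin m) (x : V) :
    ∏ j, inner ℂ (Function.update ξ i x j) (η j) =
      inner ℂ x (η i) * ∏ j ∈ Finset.univ.erase i, inner ℂ (ξ j) (η j) := by
  rw [← Finset.mul_prod_erase _ _ (Finset.mem_univ i)]
  congr 1
  · simp
  · refine Finset.prod_congr rfl fun j hj => ?_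
    rw [Function.update_of_ne (Finset.ne_of_mem_erase hj)]

theorem innerFunctional_update_add {m : ℕ} [DecidableEq (Fin m)] (ξ : Fin m → V) (i : Fin m)
    (x y : V) (z : TensorPow V m) :
    innerFunctional (Function.update ξ i (x + y)) z =
      innerFunctional (Function.update ξ i x) z + innerFunctional (Function.update ξ i y) z := by
  induction z using tensorPow_induction with
  | h1 c η => simp [prod_inner_update]; ring
  | h2 z w hz hw => simp [hz, hw]; ring

theorem innerFunctional_update_smul {m : ℕ} [DecidableEq (Fin m)] (ξ : Fin m → V) (i : Fin m)
    (c : ℂ) (x : V) (z : TensorPow V m) :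
    innerFunctional (Function.update ξ i (c • x)) z =
      starRingEnd ℂ c * innerFunctional (Function.update ξ i x) z := by
  induction z using tensorPow_induction with
  | h1 c η => simp [prod_inner_update]; ring
  | h2 z w hz hw => simp [hz, hw]; ring

/-- The sesquilinear form determined by
`⟨η₁ ⊗ ⋯ ⊗ ηₘ, ξ₁ ⊗ ⋯ ⊗ ξₘ⟩ = ∏ᵢ ⟨ηᵢ, ξᵢ⟩`, as a linear function of the right argument. -/
noncomputable def innerForm (m : ℕ) : TensorPow V m →ₗ[ℂ] TensorPow V m →ₗ⋆[ℂ] ℂ :=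
  tlift <| MultilinearMap.mk' (fun ξ : Fin m → V =>
    ({ toFun := fun y => starRingEnd ℂ (innerFunctional ξ y)
       map_add' := by simp
       map_smul' := by simp } : TensorPow V m →ₗ⋆[ℂ] ℂ))
    (by
      intro _ i x y
      ext z
      simp [innerFunctional_update_add])
    (by
      intro _ i c x
      ext z
      simp [innerFunctional_update_smul])

theorem innerForm_tmul {m : ℕ} (ξ η : Fin m → V) :
    innerForm m (tmul m ξ) (tmul m η) = ∏ i, inner ℂ (η i) (ξ i) := by
  simp [innerForm]

theorem innerForm_conj {m : ℕ} (x y : TensorPow V m) :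
    starRingEnd ℂ (innerForm m x y) = innerForm m y x := by
  induction x using tensorPow_induction with
  | h1 c ξ =>
    induction y using tensorPow_induction with
    | h1 d η => simp [innerForm_tmul]; ring
    | h2 z w hz hw => simp only [map_add, LinearMap.add_apply, hz, hw]
  | h2 z w hz hw => simp only [map_add, LinearMap.add_apply, hz, hw]

open scoped ComplexOrder in
theorem posSemidef_prod_inner {ι : Type*} [Finite ι] {m : ℕ} (v : ι → Fin m → V)
    (s : Finset (Fin m)) :
    (Matrix.of fun i j => ∏ k ∈ s, inner ℂ (v i k) (v j k) : Matrix ι ι ℂ).PosSemidef := by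
  classical
  induction s using Finset.induction_on with
  | empty =>
    have h : (Matrix.gram ℂ (fun _ : ι => (1 : ℂ))).PosSemidef := Matrix.posSemidef_gram ℂ _
    have e : (Matrix.of fun i j => ∏ k ∈ (∅ : Finset (Fin m)), inner ℂ (v i k) (v j k) :
        Matrix ι ι ℂ) = Matrix.gram ℂ (fun _ : ι => (1 : ℂ)) := by
      ext i j; simp
    rw [e]; exact h
  | insert a s ha ih =>
    have h := (Matrix.posSemidef_gram ℂ (fun i => v i a)).hadamard ih
    have e : (Matrix.of fun i j => ∏ k ∈ insert a s, inner ℂ (v i k) (v j k) :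
        Matrix ι ι ℂ) = Matrix.hadamard (Matrix.gram ℂ (fun i => v i a))
          (Matrix.of fun i j => ∏ k ∈ s, inner ℂ (v i k) (v j k)) := by
      ext i j; simp [Finset.prod_insert ha]
    rw [e]; exact h

open scoped ComplexOrder in
theorem innerForm_self_nonneg {m : ℕ} (x : TensorPow V m) : 0 ≤ (innerForm m x x).re := by
  have hx : x ∈ Submodule.span ℂ (Set.range (tmul (V := V) m)) := by
    rw [span_tmul]; trivial
  obtain ⟨c, rfl⟩ := (Finsupp.mem_span_range_iff_exists_finsupp).1 hx
  have h := (posSemidef_prod_inner (fun ξ : c.support => (ξ : Fin m → V))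
    Finset.univ).dotProduct_mulVec_nonneg (fun ξ => c ξ)
  have h' : innerForm m (c.sum fun i a => a • tmul m i) (c.sum fun i a => a • tmul m i) =
      ∑ i : c.support, ∑ j : c.support,
        star (c i) * ((∏ k, inner ℂ ((i : Fin m → V) k) ((j : Fin m → V) k)) * c j) := by
    rw [Finset.sum_coe_sort c.support (fun i => ∑ j : c.support,
        star (c i) * ((∏ k, inner ℂ (i k) ((j : Fin m → V) k)) * c j))]
    simp only [Finsupp.sum, map_sum, LinearMap.sum_apply, map_smul, LinearMap.smul_apply,
      map_smulₛₗ, innerForm_tmul, smul_eq_mul]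
    refine Finset.sum_congr rfl fun i _ => ?_
    rw [Finset.sum_coe_sort c.support (fun j =>
        star (c i) * ((∏ k, inner ℂ (i k) (j k)) * c j)), Finset.mul_sum]
    refine Finset.sum_congr rfl fun j _ => ?_
    simp only [starRingEnd_apply]; ring
  have h2 : innerForm m (c.sum fun i a => a • tmul m i) (c.sum fun i a => a • tmul m i) =
      star (fun ξ : c.support => c ξ) ⬝ᵥ (Matrix.mulVec (Matrix.of fun i j : c.support =>
        ∏ k, inner ℂ ((i : Fin m → V) k) ((j : Fin m → V) k)) (fun ξ => c ξ)) := by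
    rw [h']
    simp [dotProduct, Matrix.mulVec, Finset.mul_sum]
  rw [h2]
  exact (Complex.le_def.1 h).1

/-- The inner product `⟨ξ₁ ⊗ ⋯ ⊗ ξₘ, η₁ ⊗ ⋯ ⊗ ηₘ⟩ = ∏ᵢ ⟨ξᵢ, ηᵢ⟩` on the tensor power. -/
noncomputable instance tensorPowCore (m : ℕ) : PreInnerProductSpace.Core ℂ (TensorPow V m) where
  inner x y := innerForm m y x
  conj_inner_symm x y := innerForm_conj x y
  re_inner_nonneg x := innerForm_self_nonneg x
  add_left x y z := by simp
  smul_left x y c := by simp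

noncomputable instance (m : ℕ) : SeminormedAddCommGroup (TensorPow V m) :=
  InnerProductSpace.Core.toSeminormedAddCommGroup (𝕜 := ℂ)

noncomputable instance (m : ℕ) : InnerProductSpace ℂ (TensorPow V m) := .ofCore _

theorem inner_eq_innerForm {m : ℕ} (x y : TensorPow V m) : inner ℂ x y = innerForm m y x := rfl

theorem inner_tmul_tmul {m : ℕ} (ξ η : Fin m → V) :
    inner ℂ (tmul m ξ) (tmul m η) = ∏ i, inner ℂ (ξ i) (η i) :=
  innerForm_tmul η ξ

/-- An inner-product identity needs to be checked only on
elementary tensors. -/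
theorem inner_map_eq_of_tmul {m n : ℕ} (f : TensorPow V m →ₗ[ℂ] TensorPow V n) (r : ℂ)
    (h : ∀ ξ η : Fin m → V, inner ℂ (f (tmul m ξ)) (f (tmul m η)) =
      r * inner ℂ (tmul m ξ) (tmul m η)) (x y : TensorPow V m) :
    inner ℂ (f x) (f y) = r * inner ℂ x y := by
  induction x using tensorPow_induction with
  | h1 c ξ =>
    induction y using tensorPow_induction with
    | h1 d η => simp only [map_smul, inner_smul_left, inner_smul_right, h]; ring
    | h2 z w hz hw => simp only [map_add, inner_add_right, hz, hw]; ring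
  | h2 z w hz hw => simp only [map_add, inner_add_left, hz, hw]; ring

theorem norm_map_eq_of_tmul {m n : ℕ} (f : TensorPow V m →ₗ[ℂ] TensorPow V n) (r : ℝ) (hr : 0 ≤ r)
    (h : ∀ ξ η : Fin m → V, inner ℂ (f (tmul m ξ)) (f (tmul m η)) =
      ((r ^ 2 : ℝ) : ℂ) * inner ℂ (tmul m ξ) (tmul m η)) (x : TensorPow V m) :
    ‖f x‖ = r * ‖x‖ := by
  have h1 := inner_map_eq_of_tmul f _ h x x
  rw [inner_self_eq_norm_sq_to_K, inner_self_eq_norm_sq_to_K] at h1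
  have h2 : ‖f x‖ ^ 2 = (r * ‖x‖) ^ 2 := by
    rw [mul_pow]; apply Complex.ofReal_injective; push_cast; simpa using h1
  exact (pow_left_inj₀ (norm_nonneg _) (by positivity) two_ne_zero).1 h2

/-- The map `ξ₁ ⊗ ⋯ ⊗ ξₘ ↦ ξ_{σ⁻¹(1)} ⊗ ⋯ ⊗ ξ_{σ⁻¹(m)}` on the algebraic tensor power. -/
noncomputable def permAlg {m : ℕ} (σ : Equiv.Perm (Fin m)) : TensorPow V m →ₗ[ℂ] TensorPow V m :=
  tlift ((tmul m).domDomCongr σ⁻¹)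

@[simp] theorem permAlg_tmul {m : ℕ} (σ : Equiv.Perm (Fin m)) (ξ : Fin m → V) :
    permAlg σ (tmul m ξ) = tmul m (fun i => ξ (σ⁻¹ i)) := by
  simp [permAlg]

theorem norm_permAlg {m : ℕ} (σ : Equiv.Perm (Fin m)) (x : TensorPow V m) :
    ‖permAlg σ x‖ = 1 * ‖x‖ :=
  norm_map_eq_of_tmul _ 1 zero_le_one (fun ξ η => by
    simp only [permAlg_tmul, inner_tmul_tmul]
    rw [Equiv.prod_comp σ⁻¹ (fun i => inner ℂ (ξ i) (η i))]; simp) x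

/-- The map `ξ₁ ⊗ ⋯ ⊗ ξₘ ↦ ξ ⊗ ξ₁ ⊗ ⋯ ⊗ ξₘ` on the algebraic tensor power. -/
noncomputable def consAlg (m : ℕ) (ξ : V) : TensorPow V m →ₗ[ℂ] TensorPow V (m + 1) :=
  tlift ((tmul (m + 1)).curryLeft ξ)

@[simp] theorem consAlg_tmul {m : ℕ} (ξ : V) (η : Fin m → V) :
    consAlg m ξ (tmul m η) = tmul (m + 1) (Fin.cons ξ η : Fin (m + 1) → V) := by
  simp [consAlg]

theorem norm_consAlg {m : ℕ} (ξ : V) (x : TensorPow V m) : ‖consAlg m ξ x‖ = ‖ξ‖ * ‖x‖ :=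
  norm_map_eq_of_tmul _ ‖ξ‖ (norm_nonneg _) (fun η ζ => by
    simp only [consAlg_tmul, inner_tmul_tmul, Fin.prod_univ_succ, Fin.cons_zero, Fin.cons_succ,
      inner_self_eq_norm_sq_to_K]
    simp) x

variable (V) in
/-- The `m`-fold Hilbert space tensor power of `V`. -/
def HTensor (m : ℕ) : Type _ := UniformSpace.Completion (TensorPow V m)

noncomputable instance (m : ℕ) : NormedAddCommGroup (HTensor V m) :=
  inferInstanceAs (NormedAddCommGroup (UniformSpace.Completion (TensorPow V m)))

noncomputable instance (m : ℕ) : InnerProductSpace ℂ (HTensor V m) :=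
  inferInstanceAs (InnerProductSpace ℂ (UniformSpace.Completion (TensorPow V m)))

instance (m : ℕ) : CompleteSpace (HTensor V m) :=
  inferInstanceAs (CompleteSpace (UniformSpace.Completion (TensorPow V m)))

/-- The canonical isometry of the algebraic tensor power into its completion. -/
noncomputable def toHTensor (m : ℕ) : TensorPow V m →L[ℂ] HTensor V m :=
  (UniformSpace.Completion.toComplL : TensorPow V m →L[ℂ] UniformSpace.Completion (TensorPow V m))

theorem norm_toHTensor {m : ℕ} (x : TensorPow V m) : ‖toHTensor m x‖ = ‖x‖ :=
  UniformSpace.Completion.norm_coe x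

theorem inner_toHTensor {m : ℕ} (x y : TensorPow V m) :
    inner ℂ (toHTensor m x) (toHTensor m y) = inner ℂ x y :=
  UniformSpace.Completion.inner_coe x y

theorem htensor_induction {m : ℕ} {p : HTensor V m → Prop} (x : HTensor V m)
    (hp : IsClosed {x | p x}) (h : ∀ x, p (toHTensor m x)) : p x :=
  UniformSpace.Completion.induction_on x hp h

/-- The extension of a bounded linear map to the completed tensor powers. -/
noncomputable def hmap {m n : ℕ} (f : TensorPow V m →L[ℂ] TensorPow V n) :
    HTensor V m →L[ℂ] HTensor V n := f.completion

@[simp] theorem hmap_toHTensor {m n : ℕ} (f : TensorPow V m →L[ℂ] TensorPow V n)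
    (x : TensorPow V m) : hmap f (toHTensor m x) = toHTensor n (f x) :=
  f.completion_apply_coe x

/-- The elementary tensor `ξ₁ ⊗ ⋯ ⊗ ξₘ` in the Hilbert space tensor power. -/
noncomputable def tens {m : ℕ} (ξ : Fin m → V) : HTensor V m := toHTensor m (tmul m ξ)

theorem inner_tens_tens {m : ℕ} (ξ η : Fin m → V) :
    inner ℂ (tens ξ) (tens η) = ∏ i, inner ℂ (ξ i) (η i) := by
  rw [tens, tens, inner_toHTensor, inner_tmul_tmul]

/-- Two continuous linear maps that agree on elementary tensors are equal. -/
theorem htensor_ext {m : ℕ} {E : Type*} [NormedAddCommGroup E] [NormedSpace ℂ E]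
    {f g : HTensor V m →L[ℂ] E} (h : ∀ ξ : Fin m → V, f (tens ξ) = g (tens ξ)) : f = g := by
  ext x
  induction x using htensor_induction with
  | hp => exact isClosed_eq f.continuous g.continuous
  | h x =>
    induction x using tensorPow_induction with
    | h1 c ξ =>
      rw [map_smul, map_smul, map_smul]
      exact congrArg _ (h ξ)
    | h2 y z hy hz => rw [map_add, map_add, map_add, hy, hz]

/-- The unitary operator `σ̂ (ξ₁ ⊗ ⋯ ⊗ ξₘ) = ξ_{σ⁻¹(1)} ⊗ ⋯ ⊗ ξ_{σ⁻¹(m)}`. -/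
noncomputable def perm {m : ℕ} (σ : Equiv.Perm (Fin m)) : HTensor V m →L[ℂ] HTensor V m :=
  hmap ((permAlg σ).mkContinuous 1 fun x => (norm_permAlg σ x).le)

@[simp] theorem perm_tens {m : ℕ} (σ : Equiv.Perm (Fin m)) (ξ : Fin m → V) :
    perm σ (tens ξ) = tens fun i => ξ (σ⁻¹ i) := by
  simp [perm, tens]

/-- The operator `c(ξ) (ξ₁ ⊗ ⋯ ⊗ ξₘ) = ξ ⊗ ξ₁ ⊗ ⋯ ⊗ ξₘ`. -/
noncomputable def cOp (m : ℕ) (ξ : V) : HTensor V m →L[ℂ] HTensor V (m + 1) :=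
  hmap ((consAlg m ξ).mkContinuous ‖ξ‖ fun x => (norm_consAlg ξ x).le)

@[simp] theorem cOp_tens {m : ℕ} (ξ : V) (η : Fin m → V) :
    cOp m ξ (tens η) = tens (Fin.cons ξ η : Fin (m + 1) → V) := by
  simp [cOp, tens]

theorem norm_cOp_apply {m : ℕ} (ξ : V) (x : HTensor V m) : ‖cOp m ξ x‖ = ‖ξ‖ * ‖x‖ := by
  induction x using htensor_induction with
  | hp => exact isClosed_eq (by fun_prop) (by fun_prop)
  | h x => simp [cOp, norm_toHTensor, norm_consAlg]

/-- The operator `d(ξ) (ξ₁ ⊗ ξ₂ ⊗ ⋯ ⊗ ξₘ₊₁) = ⟨ξ, ξ₁⟩ ξ₂ ⊗ ⋯ ⊗ ξₘ₊₁`, obtained as the adjoint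
of `c(ξ)`; the formula on elementary tensors is `dOp_tens`. -/
noncomputable def dOp (m : ℕ) (ξ : V) : HTensor V (m + 1) →L[ℂ] HTensor V m :=
  ContinuousLinearMap.adjoint (cOp m ξ)

theorem dOp_tens {m : ℕ} (ξ : V) (η : Fin (m + 1) → V) :
    dOp m ξ (tens η) = inner ℂ ξ (η 0) • tens (fun i : Fin m => η i.succ) := by
  refine ext_inner_left ℂ fun x => ?_
  have h : innerSL ℂ (dOp m ξ (tens η)) =
      innerSL ℂ (inner ℂ ξ (η 0) • tens (fun i : Fin m => η i.succ)) := by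
    refine htensor_ext fun ζ => ?_
    rw [innerSL_apply_apply, innerSL_apply_apply, dOp, ContinuousLinearMap.adjoint_inner_left,
      cOp_tens, inner_tens_tens, inner_smul_left, inner_tens_tens, Fin.prod_univ_succ]
    simp
  have h' := congrArg (starRingEnd ℂ) (DFunLike.congr_fun h x)
  simpa only [innerSL_apply_apply, inner_conj_symm] using h'

/-- The symmetrization `P₊ = (1 / m!) ∑_σ σ̂`. -/
noncomputable def symmetrizer (V : Type*) [NormedAddCommGroup V] [InnerProductSpace ℂ V] (m : ℕ) :
    HTensor V m →L[ℂ] HTensor V m :=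
  ((m.factorial : ℂ)⁻¹) • ∑ σ : Equiv.Perm (Fin m), perm σ

theorem perm_mul {m : ℕ} (σ τ : Equiv.Perm (Fin m)) :
    perm (V := V) σ ∘L perm τ = perm (σ * τ) := by
  refine htensor_ext fun ξ => ?_
  simp

theorem perm_adjoint {m : ℕ} (σ : Equiv.Perm (Fin m)) :
    ContinuousLinearMap.adjoint (perm (V := V) σ) = perm σ⁻¹ := by
  refine htensor_ext fun ξ => ?_
  refine ext_inner_left ℂ fun x => ?_
  have h : innerSL ℂ (ContinuousLinearMap.adjoint (perm (V := V) σ) (tens ξ)) =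
      innerSL ℂ (perm σ⁻¹ (tens ξ)) := by
    refine htensor_ext fun ζ => ?_
    rw [innerSL_apply_apply, innerSL_apply_apply, ContinuousLinearMap.adjoint_inner_left,
      perm_tens, perm_tens, inner_tens_tens, inner_tens_tens,
      ← Equiv.prod_comp σ]
    simp
  have h' := congrArg (starRingEnd ℂ) (DFunLike.congr_fun h x)
  simpa using h'

theorem symmetrizer_adjoint (m : ℕ) :
    ContinuousLinearMap.adjoint (symmetrizer V m) = symmetrizer V m := by
  simp only [symmetrizer, map_smulₛₗ, map_sum, perm_adjoint]
  have h := Equiv.sum_comp (Equiv.inv (Equiv.Perm (Fin m))) (fun σ => perm (V := V) σ)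
  simp only [Equiv.inv_apply] at h
  rw [h]
  simp

theorem symmetrizer_inner {m : ℕ} (x y : HTensor V m) :
    inner ℂ (symmetrizer V m x) y = inner ℂ x (symmetrizer V m y) := by
  rw [← ContinuousLinearMap.adjoint_inner_left, symmetrizer_adjoint]

theorem perm_symmetrizer {m : ℕ} (σ : Equiv.Perm (Fin m)) :
    perm σ ∘L symmetrizer V m = symmetrizer V m := by
  simp only [symmetrizer, ContinuousLinearMap.comp_smul, ContinuousLinearMap.comp_finsetSum,
    perm_mul]
  have h := Equiv.sum_comp (Equiv.mulLeft σ) (fun σ => perm (V := V) σ)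
  simp only [Equiv.coe_mulLeft] at h
  rw [h]

theorem symmetrizer_idem (m : ℕ) :
    symmetrizer V m ∘L symmetrizer V m = symmetrizer V m := by
  conv_lhs => enter [1]; rw [symmetrizer]
  simp only [ContinuousLinearMap.smul_comp, ContinuousLinearMap.finsetSum_comp,
    perm_symmetrizer]
  simp [Fintype.card_perm, ← Nat.cast_smul_eq_nsmul ℂ, smul_smul, Nat.factorial_ne_zero]

theorem norm_symmetrizer_apply_le {m : ℕ} (x : HTensor V m) : ‖symmetrizer V m x‖ ≤ ‖x‖ := by
  have h : ‖symmetrizer V m x‖ * ‖symmetrizer V m x‖ ≤ ‖x‖ * ‖symmetrizer V m x‖ := by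
    rw [← sq]
    have h1 : inner ℂ (symmetrizer V m x) (symmetrizer V m x) =
        inner ℂ x (symmetrizer V m x) := by
      rw [symmetrizer_inner]
      exact congrArg _ (DFunLike.congr_fun (symmetrizer_idem m) x)
    have h2 := norm_inner_le_norm (𝕜 := ℂ) x (symmetrizer V m x)
    rw [← h1, inner_self_eq_norm_sq_to_K] at h2
    simpa using h2
  rcases (norm_nonneg (symmetrizer V m x)).eq_or_lt with h0 | h0
  · rw [← h0]; exact norm_nonneg _
  · exact le_of_mul_le_mul_right h h0

/-- The `m`-particle space `F⁺ₘ(V) = P₊ Fₘ(V)`, the symmetric Hilbert tensor power. -/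
noncomputable def SymTensor (V : Type*) [NormedAddCommGroup V] [InnerProductSpace ℂ V] (m : ℕ) :
    Submodule ℂ (HTensor V m) :=
  LinearMap.range (symmetrizer V m : HTensor V m →ₗ[ℂ] HTensor V m)

theorem symmetrizer_mem {m : ℕ} (x : HTensor V m) : symmetrizer V m x ∈ SymTensor V m := ⟨x, rfl⟩

theorem mem_symTensor {m : ℕ} {x : HTensor V m} :
    x ∈ SymTensor V m ↔ symmetrizer V m x = x := by
  constructor
  · rintro ⟨y, rfl⟩
    exact DFunLike.congr_fun (symmetrizer_idem m) y
  · intro h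
    exact ⟨x, h⟩

instance (m : ℕ) : CompleteSpace (SymTensor V m) := by
  have h : IsClosed (SymTensor V m : Set (HTensor V m)) := by
    have e : (SymTensor V m : Set (HTensor V m)) = {x | symmetrizer V m x = x} := by
      ext x; exact mem_symTensor
    rw [e]
    exact isClosed_eq (by fun_prop) (by fun_prop)
  exact h.completeSpace_coe

/-! ### The bosonic Fock space -/

/-- The bosonic Fock space `F⁺(V)`, the Hilbert space direct sum of the spaces `F⁺ₘ(V)`. -/
abbrev Fock (V : Type*) [NormedAddCommGroup V] [InnerProductSpace ℂ V] : Type _ :=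
  lp (fun m : ℕ => SymTensor V m) 2

/-- The vectors with a finite number of quanta, `(ψ₀, …, ψ_N, 0, 0, …)`. -/
noncomputable def finFock (V : Type*) [NormedAddCommGroup V] [InnerProductSpace ℂ V] :
    Submodule ℂ (Fock V) where
  carrier := {ψ | ∃ N : ℕ, ∀ m, N < m → ψ m = 0}
  zero_mem' := ⟨0, fun m _ => rfl⟩
  add_mem' := by
    rintro ψ φ ⟨N, hN⟩ ⟨M, hM⟩
    refine ⟨max N M, fun m hm => ?_⟩
    rw [lp.coeFn_add, Pi.add_apply, hN m (lt_of_le_of_lt (le_max_left _ _) hm),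
      hM m (lt_of_le_of_lt (le_max_right _ _) hm), add_zero]
  smul_mem' := by
    rintro c ψ ⟨N, hN⟩
    exact ⟨N, fun m hm => by rw [lp.coeFn_smul, Pi.smul_apply, hN m hm, smul_zero]⟩

theorem tens_mem_symTensor_zero : tens (V := V) (Fin.elim0 : Fin 0 → V) ∈ SymTensor V 0 := by
  rw [mem_symTensor, symmetrizer]
  simp only [Fintype.sum_unique, Nat.factorial_zero, Nat.cast_one, inv_one, one_smul, perm_tens]
  congr 1

/-- The Fock vacuum `|0⟩ = (1, 0, 0, …)`; the unit of `F₀(V) = ℂ` is the empty tensor. -/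
noncomputable def vacuum (V : Type*) [NormedAddCommGroup V] [InnerProductSpace ℂ V] : Fock V :=
  lp.single 2 0 ⟨tens (Fin.elim0 : Fin 0 → V), tens_mem_symTensor_zero⟩

/-- For a complex subspace `U` of `V`, the tensor power `Fₘ(U)` as a subspace of `Fₘ(V)`. -/
noncomputable def tensorOver (U : Submodule ℂ V) (m : ℕ) : Submodule ℂ (HTensor V m) :=
  (Submodule.span ℂ {x | ∃ u : Fin m → V, (∀ i, u i ∈ U) ∧ x = tens u}).topologicalClosure

/-- For a complex subspace `U` of `V`, the Fock space `F⁺(U)` as a subspace of `F⁺(V)`: its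
elements are the `ψ = (ψ₀, ψ₁, …)` with `ψₘ ∈ P₊ Fₘ(U)` for all `m`. -/
noncomputable def fockOver (U : Submodule ℂ V) : Submodule ℂ (Fock V) where
  carrier := {ψ | ∀ m, (ψ m : HTensor V m) ∈
    (tensorOver U m).map (symmetrizer V m : HTensor V m →ₗ[ℂ] HTensor V m)}
  zero_mem' := fun _ => Submodule.zero_mem _
  add_mem' := fun hψ hφ m => Submodule.add_mem _ (hψ m) (hφ m)
  smul_mem' := fun c _ hψ m => Submodule.smul_mem _ c (hψ m)

/-! ### Creation and annihilation operators -/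

/-- The creation operator `P₊ √N c(ξ) P₊` from the `m`-particle to the `(m+1)`-particle space. -/
noncomputable def createSector (m : ℕ) (ξ : V) : SymTensor V m →L[ℂ] SymTensor V (m + 1) :=
  ContinuousLinearMap.codRestrict
    (symmetrizer V (m + 1) ∘L
      (((Real.sqrt (m + 1) : ℝ) : ℂ) • cOp m ξ) ∘L (SymTensor V m).subtypeL)
    (SymTensor V (m + 1)) (fun _ => symmetrizer_mem _)

/-- The annihilation operator `P₊ √(N+1) d(ξ) P₊` from the `(m+1)`-particle to the `m`-particle
space. -/
noncomputable def annihilateSector (m : ℕ) (ξ : V) : SymTensor V (m + 1) →L[ℂ] SymTensor V m :=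
  ContinuousLinearMap.codRestrict
    (symmetrizer V m ∘L
      (((Real.sqrt (m + 1) : ℝ) : ℂ) • dOp m ξ) ∘L (SymTensor V (m + 1)).subtypeL)
    (SymTensor V m) (fun _ => symmetrizer_mem _)

theorem coe_createSector (m : ℕ) (ξ : V) (x : SymTensor V m) :
    (createSector m ξ x : HTensor V (m + 1)) =
      symmetrizer V (m + 1) (((Real.sqrt (m + 1) : ℝ) : ℂ) • cOp m ξ x) := rfl

theorem coe_annihilateSector (m : ℕ) (ξ : V) (x : SymTensor V (m + 1)) :
    (annihilateSector m ξ x : HTensor V m) =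
      symmetrizer V m (((Real.sqrt (m + 1) : ℝ) : ℂ) • dOp m ξ x) := rfl

theorem inner_createSector (m : ℕ) (ξ : V) (x : SymTensor V m) (y : SymTensor V (m + 1)) :
    inner ℂ (createSector m ξ x) y = inner ℂ x (annihilateSector m ξ y) := by
  rw [Submodule.coe_inner, Submodule.coe_inner, coe_createSector, coe_annihilateSector,
    symmetrizer_inner, mem_symTensor.1 y.2, ← symmetrizer_inner, mem_symTensor.1 x.2,
    inner_smul_left, inner_smul_right, dOp, ContinuousLinearMap.adjoint_inner_right]
  simp

theorem norm_createSector_le (m : ℕ) (ξ : V) (x : SymTensor V m) :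
    ‖createSector m ξ x‖ ≤ Real.sqrt (m + 1) * ‖ξ‖ * ‖x‖ := by
  change ‖(createSector m ξ x : HTensor V (m + 1))‖ ≤ _
  rw [coe_createSector]
  refine (norm_symmetrizer_apply_le _).trans (le_of_eq ?_)
  rw [norm_smul, norm_cOp_apply, Complex.norm_real, Real.norm_of_nonneg (Real.sqrt_nonneg _),
    mul_assoc, Submodule.coe_norm]

theorem norm_annihilateSector_le (m : ℕ) (ξ : V) (x : SymTensor V (m + 1)) :
    ‖annihilateSector m ξ x‖ ≤ Real.sqrt (m + 1) * ‖ξ‖ * ‖x‖ := by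
  change ‖(annihilateSector m ξ x : HTensor V m)‖ ≤ _
  rw [coe_annihilateSector]
  refine (norm_symmetrizer_apply_le _).trans ?_
  rw [norm_smul, Complex.norm_real, Real.norm_of_nonneg (Real.sqrt_nonneg _), mul_assoc]
  refine mul_le_mul_of_nonneg_left ?_ (Real.sqrt_nonneg _)
  have h : ‖dOp m ξ‖ ≤ ‖ξ‖ := by
    rw [dOp, LinearIsometryEquiv.norm_map]
    exact ContinuousLinearMap.opNorm_le_bound _ (norm_nonneg _) fun x => (norm_cOp_apply ξ x).le
  exact (dOp m ξ).le_of_opNorm_le h x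

/-- An eventually vanishing sequence of `m`-particle vectors, as an element of the Fock space. -/
noncomputable def ofFin (f : ∀ m, SymTensor V m) (hf : ∃ N : ℕ, ∀ m, N < m → f m = 0) :
    finFock V :=
  ⟨⟨f, (memℓp_zero (by
      obtain ⟨N, hN⟩ := hf
      refine (Set.finite_Iic N).subset fun m hm => ?_
      by_contra h
      exact hm (hN m (not_le.1 h)))).of_exponent_ge zero_le⟩, hf⟩

/-- The sequence `(0, a†(ξ) f₀, a†(ξ) f₁, …)`. -/
noncomputable def createSeq (ξ : V) (f : ∀ m, SymTensor V m) : ∀ m, SymTensor V m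
  | 0 => 0
  | m + 1 => createSector m ξ (f m)

/-- The creation operator `a†(ξ)` on the finite-particle vectors. -/
noncomputable def create (ξ : V) : finFock V →ₗ[ℂ] finFock V where
  toFun ψ := ofFin (createSeq ξ (ψ : Fock V)) (by
    obtain ⟨N, hN⟩ := ψ.2
    refine ⟨N + 1, fun m hm => ?_⟩
    cases m with
    | zero => rfl
    | succ m => simp only [createSeq]; rw [hN m (by lia), map_zero])
  map_add' ψ φ := by
    refine Subtype.ext (lp.ext (funext fun m => ?_))
    cases m with
    | zero => exact (add_zero _).symm
    | succ m => exact map_add (createSector m ξ) _ _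
  map_smul' c ψ := by
    refine Subtype.ext (lp.ext (funext fun m => ?_))
    cases m with
    | zero => exact (smul_zero c).symm
    | succ m => exact map_smul (createSector m ξ) _ _

/-- The annihilation operator `a(ξ)` on the finite-particle vectors. -/
noncomputable def annihilate (ξ : V) : finFock V →ₗ[ℂ] finFock V where
  toFun ψ := ofFin (fun m => annihilateSector m ξ ((ψ : Fock V) (m + 1))) (by
    obtain ⟨N, hN⟩ := ψ.2
    refine ⟨N, fun m hm => ?_⟩
    rw [hN (m + 1) (by lia), map_zero])
  map_add' ψ φ := by
    refine Subtype.ext (lp.ext (funext fun m => ?_))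
    exact map_add (annihilateSector m ξ) _ _
  map_smul' c ψ := by
    refine Subtype.ext (lp.ext (funext fun m => ?_))
    exact map_smul (annihilateSector m ξ) _ _

theorem create_apply_zero (ξ : V) (ψ : finFock V) : (create ξ ψ : Fock V) 0 = 0 := rfl

theorem create_apply_succ (ξ : V) (ψ : finFock V) (m : ℕ) :
    (create ξ ψ : Fock V) (m + 1) = createSector m ξ ((ψ : Fock V) m) := rfl

theorem annihilate_apply (ξ : V) (ψ : finFock V) (m : ℕ) :
    (annihilate ξ ψ : Fock V) m = annihilateSector m ξ ((ψ : Fock V) (m + 1)) := rfl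

theorem inner_create (ξ : V) (ψ φ : finFock V) :
    inner ℂ (create ξ ψ : Fock V) (φ : Fock V) =
      inner ℂ (ψ : Fock V) (annihilate ξ φ : Fock V) := by
  rw [lp.inner_eq_tsum, lp.inner_eq_tsum,
    (lp.summable_inner (𝕜 := ℂ) (create ξ ψ : Fock V) (φ : Fock V)).tsum_eq_zero_add]
  rw [create_apply_zero, inner_zero_left, zero_add]
  exact tsum_congr fun m => inner_createSector m ξ _ _

theorem inner_annihilate (ξ : V) (ψ φ : finFock V) :
    inner ℂ (annihilate ξ ψ : Fock V) (φ : Fock V) =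
      inner ℂ (ψ : Fock V) (create ξ φ : Fock V) := by
  have h := congrArg (starRingEnd ℂ) (inner_create ξ φ ψ)
  rw [inner_conj_symm, inner_conj_symm] at h
  exact h.symm

/-! ### Weyl operators -/

/-- The operator `a†(ξ) - a(ξ)` on the finite-particle vectors. -/
noncomputable def weylGen (ξ : V) : finFock V →ₗ[ℂ] finFock V := create ξ - annihilate ξ

theorem coe_weylGen (ξ : V) (ψ : finFock V) :
    (weylGen ξ ψ : Fock V) = (create ξ ψ : Fock V) - (annihilate ξ ψ : Fock V) := rfl

theorem inner_weylGen (ξ : V) (ψ φ : finFock V) :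
    inner ℂ (weylGen ξ ψ : Fock V) (φ : Fock V) =
      -inner ℂ (ψ : Fock V) (weylGen ξ φ : Fock V) := by
  rw [coe_weylGen, coe_weylGen, inner_sub_left, inner_sub_right, inner_create, inner_annihilate]
  ring

theorem inner_weylGen_pow (ξ : V) (k : ℕ) (ψ φ : finFock V) :
    inner ℂ ((weylGen ξ ^ k) ψ : Fock V) (φ : Fock V) =
      (-1) ^ k * inner ℂ (ψ : Fock V) ((weylGen ξ ^ k) φ : Fock V) := by
  induction k generalizing ψ φ with
  | zero => simp
  | succ k ih =>
    rw [pow_succ', Module.End.mul_apply, inner_weylGen, ih, ← pow_succ', pow_succ (weylGen ξ),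
      Module.End.mul_apply]
    ring

/-- The finite-particle vector with `x` in the `n`-particle space. -/
noncomputable def finSingle (n : ℕ) (x : SymTensor V n) : finFock V :=
  ⟨lp.single (E := fun m : ℕ => ↥(SymTensor V m)) 2 n x, n, fun _ hm =>
    lp.single_apply_ne (E := fun m : ℕ => ↥(SymTensor V m)) 2 n x hm.ne'⟩

theorem finSingle_self (n : ℕ) (x : SymTensor V n) : (finSingle n x : Fock V) n = x :=
  lp.single_apply_self (E := fun m : ℕ => ↥(SymTensor V m)) 2 n x

theorem finSingle_ne {n m : ℕ} (h : m ≠ n) (x : SymTensor V n) :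
    (finSingle n x : Fock V) m = 0 :=
  lp.single_apply_ne (E := fun m : ℕ => ↥(SymTensor V m)) 2 n x h

theorem norm_finSingle (n : ℕ) (x : SymTensor V n) : ‖finSingle n x‖ = ‖x‖ :=
  lp.norm_single (E := fun m : ℕ => ↥(SymTensor V m)) (p := 2) (by norm_num) n x

theorem create_finSingle (ξ : V) (n : ℕ) (x : SymTensor V n) :
    create ξ (finSingle n x) = finSingle (n + 1) (createSector n ξ x) := by
  refine Subtype.ext (lp.ext (funext fun m => ?_))
  cases m with
  | zero => exact (finSingle_ne (by lia) _).symm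
  | succ m =>
    rw [create_apply_succ]
    by_cases h : m = n
    · subst h
      rw [finSingle_self, finSingle_self]
    · rw [finSingle_ne h, finSingle_ne (by lia), map_zero]

theorem annihilate_finSingle_zero (ξ : V) (x : SymTensor V 0) :
    annihilate ξ (finSingle 0 x) = 0 := by
  refine Subtype.ext (lp.ext (funext fun m => ?_))
  rw [annihilate_apply, finSingle_ne (by lia), map_zero]
  rfl

theorem annihilate_finSingle_succ (ξ : V) (n : ℕ) (x : SymTensor V (n + 1)) :
    annihilate ξ (finSingle (n + 1) x) = finSingle n (annihilateSector n ξ x) := by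
  refine Subtype.ext (lp.ext (funext fun m => ?_))
  rw [annihilate_apply]
  by_cases h : m = n
  · subst h
    rw [finSingle_self, finSingle_self]
  · rw [finSingle_ne h, finSingle_ne (by lia), map_zero]

theorem finFock_eq_sum (ψ : finFock V) :
    ∃ N : ℕ, ψ = ∑ n ∈ Finset.range N, finSingle n ((ψ : Fock V) n) := by
  obtain ⟨N, hN⟩ := ψ.2
  refine ⟨N + 1, Subtype.ext (lp.ext (funext fun m => ?_))⟩
  rw [Submodule.coe_sum, lp.coeFn_sum, Finset.sum_apply]
  by_cases hm : N < m
  · rw [hN m hm, Finset.sum_eq_zero]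
    intro n hn
    have := Finset.mem_range.1 hn
    exact finSingle_ne (by lia) _
  · rw [Finset.sum_eq_single m]
    · exact (finSingle_self m _).symm
    · intro n _ hn
      exact finSingle_ne hn.symm _
    · intro h
      exact absurd (Finset.mem_range.2 (by lia)) h

/-- The product `√(n+1) √(n+2) ⋯ √(n+k)`. -/
noncomputable def sqrtProd (n k : ℕ) : ℝ := ∏ i ∈ Finset.range k, Real.sqrt (n + 1 + i)

theorem sqrtProd_nonneg (n k : ℕ) : 0 ≤ sqrtProd n k :=
  Finset.prod_nonneg fun _ _ => Real.sqrt_nonneg _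

theorem sqrtProd_mono {n m : ℕ} (h : n ≤ m) (k : ℕ) : sqrtProd n k ≤ sqrtProd m k := by
  refine Finset.prod_le_prod (fun _ _ => Real.sqrt_nonneg _) fun i _ => Real.sqrt_le_sqrt ?_
  have : (n : ℝ) ≤ m := by exact_mod_cast h
  linarith

theorem sqrtProd_succ (n k : ℕ) :
    sqrtProd n (k + 1) = Real.sqrt (n + 1) * sqrtProd (n + 1) k := by
  rw [sqrtProd, Finset.prod_range_succ', mul_comm, sqrtProd]
  push_cast
  congr 1
  · simp
  · exact Finset.prod_congr rfl fun i _ => by ring_nf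

theorem sqrtProd_sq_le (n k : ℕ) : sqrtProd n k ^ 2 ≤ 2 ^ (n + k) * (k.factorial : ℝ) := by
  have h : sqrtProd n k ^ 2 = ((n + 1).ascFactorial k : ℝ) := by
    induction k with
    | zero => simp [sqrtProd]
    | succ k ih =>
      rw [sqrtProd, Finset.prod_range_succ, ← sqrtProd, mul_pow, ih, Real.sq_sqrt (by positivity),
        Nat.ascFactorial_succ]
      push_cast
      ring
  rw [h, Nat.ascFactorial_eq_factorial_mul_choose]
  have h2 : (n + k).choose k ≤ 2 ^ (n + k) := Nat.choose_le_two_pow _ _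
  have h3 : (((n + k).choose k : ℕ) : ℝ) ≤ 2 ^ (n + k) := by exact_mod_cast h2
  push_cast
  rw [mul_comm]
  gcongr

theorem norm_weylGen_pow_finSingle_le (ξ : V) (k n : ℕ) (x : SymTensor V n) :
    ‖(weylGen ξ ^ k) (finSingle n x)‖ ≤ (2 * ‖ξ‖) ^ k * sqrtProd n k * ‖x‖ := by
  induction k generalizing n x with
  | zero =>
    rw [pow_zero, pow_zero, Module.End.one_apply, norm_finSingle, sqrtProd, Finset.prod_range_zero,
      one_mul, one_mul]
  | succ k ih =>
    have key : ∀ (r s : ℝ), 0 ≤ s → r ≤ s → ∀ j, j ≤ n + 1 → ∀ y : SymTensor V j,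
        ‖y‖ ≤ s * ‖ξ‖ * ‖x‖ → s ≤ Real.sqrt (n + 1) →
        ‖(weylGen ξ ^ k) (finSingle j y)‖ ≤
          (2 * ‖ξ‖) ^ k * ‖ξ‖ * sqrtProd n (k + 1) * ‖x‖ := by
      intro r s hs _ j hj y hy hs'
      refine (ih j y).trans ?_
      rw [sqrtProd_succ]
      calc (2 * ‖ξ‖) ^ k * sqrtProd j k * ‖y‖
          ≤ (2 * ‖ξ‖) ^ k * sqrtProd (n + 1) k * (Real.sqrt (n + 1) * ‖ξ‖ * ‖x‖) := by
            have h1 := sqrtProd_mono hj k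
            have h2 := sqrtProd_nonneg (n + 1) k
            have h3 : ‖y‖ ≤ Real.sqrt (n + 1) * ‖ξ‖ * ‖x‖ := hy.trans (by gcongr)
            gcongr
        _ = _ := by ring
    have h1 : ‖(weylGen ξ ^ k) (create ξ (finSingle n x))‖ ≤
        (2 * ‖ξ‖) ^ k * ‖ξ‖ * sqrtProd n (k + 1) * ‖x‖ := by
      rw [create_finSingle]
      exact key _ (Real.sqrt (n + 1)) (Real.sqrt_nonneg _) le_rfl _ le_rfl _
        (norm_createSector_le n ξ x) le_rfl
    have h2 : ‖(weylGen ξ ^ k) (annihilate ξ (finSingle n x))‖ ≤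
        (2 * ‖ξ‖) ^ k * ‖ξ‖ * sqrtProd n (k + 1) * ‖x‖ := by
      cases n with
      | zero =>
        rw [annihilate_finSingle_zero, map_zero, norm_zero]
        have := sqrtProd_nonneg 0 (k + 1)
        positivity
      | succ n =>
        rw [annihilate_finSingle_succ]
        refine key _ (Real.sqrt (n + 1)) (Real.sqrt_nonneg _) le_rfl _ (by lia) _
          (norm_annihilateSector_le n ξ x) (Real.sqrt_le_sqrt ?_)
        push_cast
        linarith
    rw [pow_succ (weylGen ξ), Module.End.mul_apply, weylGen, LinearMap.sub_apply, map_sub,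
      ← weylGen]
    refine (norm_sub_le _ _).trans ((add_le_add h1 h2).trans (le_of_eq ?_))
    rw [pow_succ (2 * ‖ξ‖)]
    ring

theorem summable_weylGen_bound (s : ℝ) (n : ℕ) :
    Summable fun k : ℕ => s ^ k * sqrtProd n k / k.factorial := by
  have h1 : Summable fun k : ℕ => (2 ^ n * ((8 * s ^ 2) ^ k / k.factorial) + (1 / 4 : ℝ) ^ k) / 2 :=
    (((Real.summable_pow_div_factorial (8 * s ^ 2)).mul_left _).add
      (summable_geometric_of_lt_one (by norm_num) (by norm_num))).div_const 2
  refine Summable.of_norm_bounded h1 fun k => ?_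
  have hk : (0 : ℝ) < k.factorial := by exact_mod_cast k.factorial_pos
  set x : ℝ := (2 * |s|) ^ k * sqrtProd n k / k.factorial with hx
  set y : ℝ := (1 / 2 : ℝ) ^ k with hy
  have e : ‖s ^ k * sqrtProd n k / k.factorial‖ = x * y := by
    rw [Real.norm_eq_abs, abs_div, abs_mul, abs_pow, abs_of_nonneg (sqrtProd_nonneg n k),
      abs_of_pos hk, hx, hy, mul_pow, one_div, inv_pow]
    field_simp
  have hx2 : x ^ 2 ≤ 2 ^ n * ((8 * s ^ 2) ^ k / k.factorial) := by
    have e2 : x ^ 2 = (4 * s ^ 2) ^ k * sqrtProd n k ^ 2 / (k.factorial : ℝ) ^ 2 := by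
      rw [hx, div_pow, mul_pow, ← pow_mul, mul_comm k 2, pow_mul, mul_pow, sq_abs]
      norm_num
    rw [e2]
    calc (4 * s ^ 2) ^ k * sqrtProd n k ^ 2 / (k.factorial : ℝ) ^ 2
        ≤ (4 * s ^ 2) ^ k * (2 ^ (n + k) * (k.factorial : ℝ)) / (k.factorial : ℝ) ^ 2 := by
          have := sqrtProd_sq_le n k
          gcongr
      _ = _ := by
          rw [show (8 : ℝ) * s ^ 2 = 2 * (4 * s ^ 2) by ring, mul_pow 2 (4 * s ^ 2), pow_add]
          field_simp
  have hy2 : y ^ 2 = (1 / 4 : ℝ) ^ k := by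
    rw [hy, ← pow_mul, mul_comm k 2, pow_mul]; norm_num
  rw [e]
  nlinarith [sq_nonneg (x - y)]

theorem summable_norm_weylGen (ξ : V) (ψ : finFock V) :
    Summable fun k : ℕ => ‖((k.factorial : ℂ)⁻¹ • (weylGen ξ ^ k) ψ : finFock V)‖ := by
  obtain ⟨N, hN⟩ := finFock_eq_sum ψ
  rw [hN]
  have h : Summable fun k : ℕ => ∑ n ∈ Finset.range N,
      (2 * ‖ξ‖) ^ k * sqrtProd n k / k.factorial * ‖(ψ : Fock V) n‖ :=
    summable_sum fun n _ => (summable_weylGen_bound _ n).mul_right _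
  refine h.of_nonneg_of_le (fun _ => norm_nonneg _) fun k => ?_
  rw [map_sum, Finset.smul_sum]
  refine (norm_sum_le _ _).trans (Finset.sum_le_sum fun n _ => ?_)
  rw [norm_smul, norm_inv, Complex.norm_natCast]
  calc (k.factorial : ℝ)⁻¹ * ‖(weylGen ξ ^ k) (finSingle n ((ψ : Fock V) n))‖
      ≤ (k.factorial : ℝ)⁻¹ * ((2 * ‖ξ‖) ^ k * sqrtProd n k * ‖(ψ : Fock V) n‖) := by
        gcongr
        exact norm_weylGen_pow_finSingle_le ξ k n _
    _ = _ := by ring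

/-- The terms of the exponential series of `a†(ξ) - a(ξ)` at a finite-particle vector. -/
noncomputable def weylTerm (ξ : V) (ψ : finFock V) (k : ℕ) : Fock V :=
  (k.factorial : ℂ)⁻¹ • (((weylGen ξ ^ k) ψ : finFock V) : Fock V)

theorem summable_norm_weylTerm (ξ : V) (ψ : finFock V) : Summable fun k => ‖weylTerm ξ ψ k‖ :=
  summable_norm_weylGen ξ ψ

theorem summable_weylTerm (ξ : V) (ψ : finFock V) : Summable (weylTerm ξ ψ) :=
  (summable_norm_weylTerm ξ ψ).of_norm

/-- The exponential `e^{a†(ξ) - a(ξ)} ψ = ∑ₖ (a†(ξ) - a(ξ))ᵏ ψ / k!` of finite-particle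
vectors `ψ`. -/
noncomputable def weylFin (ξ : V) : finFock V →ₗ[ℂ] Fock V where
  toFun ψ := ∑' k, weylTerm ξ ψ k
  map_add' ψ φ := by
    rw [← (summable_weylTerm ξ ψ).tsum_add (summable_weylTerm ξ φ)]
    refine tsum_congr fun k => ?_
    simp only [weylTerm, map_add, Submodule.coe_add, smul_add]
  map_smul' c ψ := by
    rw [RingHom.id_apply, ← (summable_weylTerm ξ ψ).tsum_const_smul]
    refine tsum_congr fun k => ?_
    simp only [weylTerm, map_smul, Submodule.coe_smul, smul_comm c]

theorem inner_weylTerm (ξ : V) (ψ φ : finFock V) (j k : ℕ) :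
    inner ℂ (weylTerm ξ ψ j) (weylTerm ξ φ k) =
      ((-1) ^ j * (j.factorial : ℂ)⁻¹ * (k.factorial : ℂ)⁻¹) *
        inner ℂ (ψ : Fock V) ((weylGen ξ ^ (j + k)) φ : Fock V) := by
  have h := inner_weylGen_pow ξ j ψ ((weylGen ξ ^ k) φ)
  rw [← Module.End.mul_apply, ← pow_add] at h
  rw [weylTerm, weylTerm, inner_smul_left, inner_smul_right, h]
  simp only [map_inv₀, map_natCast]
  ring

theorem sum_antidiagonal_sign (n : ℕ) :
    ∑ p ∈ Finset.HasAntidiagonal.antidiagonal n,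
      ((-1 : ℂ) ^ p.1 * (p.1.factorial : ℂ)⁻¹ * (p.2.factorial : ℂ)⁻¹) = if n = 0 then 1 else 0 := by
  have h := (Commute.all (-1 : ℂ) 1).add_pow' n
  rw [neg_add_cancel, zero_pow_eq] at h
  have hn : (n.factorial : ℂ) ≠ 0 := by exact_mod_cast n.factorial_ne_zero
  have e : ∑ p ∈ Finset.HasAntidiagonal.antidiagonal n,
      ((-1 : ℂ) ^ p.1 * (p.1.factorial : ℂ)⁻¹ * (p.2.factorial : ℂ)⁻¹) =
      (n.factorial : ℂ)⁻¹ * (if n = 0 then 1 else 0) := by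
    rw [h, Finset.mul_sum]
    refine Finset.sum_congr rfl fun p hp => ?_
    have hp' := Finset.HasAntidiagonal.mem_antidiagonal.1 hp
    have h1 : (p.1.factorial : ℂ) ≠ 0 := by exact_mod_cast p.1.factorial_ne_zero
    have h2 : (p.2.factorial : ℂ) ≠ 0 := by exact_mod_cast p.2.factorial_ne_zero
    have h3 : (n.choose p.1 : ℂ) * p.1.factorial * p.2.factorial = n.factorial := by
      rw [← hp']
      have := Nat.add_choose_mul_factorial_mul_factorial p.2 p.1
      rw [add_comm p.2 p.1] at this
      rw [mul_right_comm]
      exact_mod_cast this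
    have h4 : (n.factorial : ℂ)⁻¹ * (n.choose p.1 : ℂ) =
        (p.1.factorial : ℂ)⁻¹ * (p.2.factorial : ℂ)⁻¹ := by
      rw [← h3] at hn ⊢
      have hc : (n.choose p.1 : ℂ) ≠ 0 := left_ne_zero_of_mul (left_ne_zero_of_mul hn)
      field_simp
    rw [nsmul_eq_mul, ← mul_assoc, h4, one_pow]
    ring
  rw [e]
  split_ifs with h0
  · subst h0; simp
  · simp

theorem inner_weylFin (ξ : V) (ψ φ : finFock V) :
    inner ℂ (weylFin ξ ψ) (weylFin ξ φ) = inner ℂ (ψ : Fock V) (φ : Fock V) := by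
  have hs : Summable fun p : ℕ × ℕ => inner ℂ (weylTerm ξ ψ p.1) (weylTerm ξ φ p.2) := by
    refine Summable.of_norm_bounded
      ((summable_norm_weylTerm ξ ψ).mul_of_nonneg (summable_norm_weylTerm ξ φ)
        (fun _ => norm_nonneg _) fun _ => norm_nonneg _) fun p => ?_
    exact norm_inner_le_norm _ _
  have h1 : inner ℂ (weylFin ξ ψ) (weylFin ξ φ) =
      ∑' p : ℕ × ℕ, inner ℂ (weylTerm ξ ψ p.1) (weylTerm ξ φ p.2) := by
    rw [hs.tsum_prod]
    have hj : ∀ j, ∑' k, inner ℂ (weylTerm ξ ψ j) (weylTerm ξ φ k) =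
        inner ℂ (weylTerm ξ ψ j) (weylFin ξ φ) := fun j =>
      ((innerSL ℂ (weylTerm ξ ψ j)).map_tsum (summable_weylTerm ξ φ)).symm
    simp only [hj]
    have hk := ((innerSL ℂ (weylFin ξ φ)).map_tsum (summable_weylTerm ξ ψ))
    have hk' := congrArg (starRingEnd ℂ) hk
    rw [← RCLike.star_def, tsum_star] at hk'
    simp only [RCLike.star_def] at hk'
    simp only [innerSL_apply_apply, inner_conj_symm] at hk'
    exact hk'
  rw [h1, ← (Finset.HasAntidiagonal.sigmaAntidiagonalEquivProd (A := ℕ)).tsum_eq]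
  refine (((Finset.HasAntidiagonal.sigmaAntidiagonalEquivProd
    (A := ℕ)).summable_iff.2 hs).tsum_sigma).trans ?_
  have h2 : ∀ n : ℕ, ∑' p : Finset.HasAntidiagonal.antidiagonal n,
      inner ℂ (weylTerm ξ ψ (p : ℕ × ℕ).1) (weylTerm ξ φ (p : ℕ × ℕ).2) =
      (if n = 0 then 1 else 0) * inner ℂ (ψ : Fock V) ((weylGen ξ ^ n) φ : Fock V) := by
    intro n
    rw [Finset.tsum_subtype (Finset.HasAntidiagonal.antidiagonal n) (fun p =>
      inner ℂ (weylTerm ξ ψ p.1) (weylTerm ξ φ p.2)), ← sum_antidiagonal_sign, Finset.sum_mul]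
    refine Finset.sum_congr rfl fun p hp => ?_
    rw [inner_weylTerm, Finset.HasAntidiagonal.mem_antidiagonal.1 hp]
  refine (tsum_congr h2).trans ?_
  rw [tsum_eq_single 0 (fun n hn => by rw [if_neg hn, zero_mul])]
  simp

theorem norm_weylFin (ξ : V) (ψ : finFock V) : ‖weylFin ξ ψ‖ = 1 * ‖ψ‖ := by
  have h := inner_weylFin ξ ψ ψ
  rw [inner_self_eq_norm_sq_to_K, inner_self_eq_norm_sq_to_K] at h
  have h2 : ‖weylFin ξ ψ‖ ^ 2 = ‖(ψ : Fock V)‖ ^ 2 := by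
    apply Complex.ofReal_injective
    simpa using h
  rw [one_mul]
  exact (pow_left_inj₀ (norm_nonneg _) (norm_nonneg _) two_ne_zero).1 h2

theorem denseRange_finFock : DenseRange (finFock V).subtypeL := by
  intro ψ
  refine mem_closure_of_tendsto (lp.hasSum_single (E := fun m => SymTensor V m) (p := 2)
    (by norm_num) ψ) (Filter.Eventually.of_forall fun s => ?_)
  refine ⟨∑ n ∈ s, finSingle n (ψ n), ?_⟩
  rw [map_sum]
  rfl

/-- The Weyl operator `W_F(ξ) = e^{a†(ξ) - a(ξ)}`: the continuous extension to the Fock space of the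
exponential series on the dense subspace of finite-particle vectors. -/
noncomputable def weyl (ξ : V) : Fock V →L[ℂ] Fock V :=
  ((weylFin ξ).mkContinuous 1 fun ψ => (norm_weylFin ξ ψ).le).extend (finFock V).subtypeL

theorem weyl_coe (ξ : V) (ψ : finFock V) : weyl ξ (ψ : Fock V) = ∑' k, weylTerm ξ ψ k :=
  ContinuousLinearMap.extend_eq _ denseRange_finFock
    (finFock V).subtypeₗᵢ.isometry.isUniformInducing ψ

theorem norm_weyl_apply (ξ : V) (ψ : Fock V) : ‖weyl ξ ψ‖ = ‖ψ‖ := by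
  refine isClosed_property (p := fun ψ : Fock V => ‖weyl ξ ψ‖ = ‖ψ‖) denseRange_finFock
    (isClosed_eq (weyl ξ).continuous.norm continuous_norm) (fun φ => ?_) ψ
  exact (congrArg norm (weyl_coe ξ φ)).trans ((norm_weylFin ξ φ).trans (one_mul _))

end
end FockSpace

namespace FockSpace

section

variable {V : Type*} [NormedAddCommGroup V] [InnerProductSpace ℂ V]

/-! ### The canonical commutation relation -/

/-! Fix `ξ` and put `G = a†(ξ) - a(ξ)`. The commutation relation `[a(ξ), a†(ξ)] = ‖ξ‖²` makes
`[a(ξ), G]` the scalar `c = ‖ξ‖²`. For the moments `Mₖ(φ, ψ) = ⟨φ, Gᵏ ψ⟩` of finite-particle vectors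
it follows that the operator `D : M ↦ (Mₖ₊₁ + c k Mₖ₋₁)` satisfies `D M(φ, ψ) = M(aφ, ψ) - M(φ, aψ)`
(`heisenbergShift_moment`). Everything rests on this identity.

(i) If `a(ξ)ψ = 0`, then `D M(ψ, ψ) = 0`. This is a recursion whose solution is fixed by `M₀`, so
the moments of `ψ` are `‖ψ‖²` times those of the vacuum. Summing the exponential series gives the
claim for finite-particle vectors; truncation and continuity of the Weyl operator give it for all
vectors over the orthogonal complement, whose truncations are annihilated by every `a(ξ)` with `ξ ∈
W`.

(ii) Since `W` is closed under real multiples, the condition at all `tξ` compares two power series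
in `t`, so all moments of `ψ` agree with those of the vacuum. Let `n ≥ 1` bound the particle number
of `ψ`. Then `aⁿ⁺¹ψ = 0`, and applying `D` to the moments `2n` times leaves only `± (2n choose n)
M(aⁿψ, aⁿψ)` (`heisenbergShift_pow_moment`). The moments of the vacuum are already killed by one
application of `D`, so `aⁿψ = 0`. Pairing with the vacuum shows that the component `ψₙ` is
orthogonal to `ξ ⊗ ⋯ ⊗ ξ` for every `ξ ∈ W`; polarization and density force `ψₙ = 0`
(`symTensor_eq_zero`). Descending in `n`, only the vacuum component survives. -/

theorem symmetrizer_tens {m : ℕ} (η : Fin m → V) :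
    symmetrizer V m (tens η) =
      (m.factorial : ℂ)⁻¹ • ∑ τ : Equiv.Perm (Fin m), tens fun i => η (τ i) := by
  rw [symmetrizer, smul_apply, sum_apply]
  congr 1
  rw [← Equiv.sum_comp (Equiv.inv (Equiv.Perm (Fin m)))]
  simp

theorem symmetrizer_tens_perm {m : ℕ} (σ : Equiv.Perm (Fin m)) (η : Fin m → V) :
    symmetrizer V m (tens fun i => η (σ i)) = symmetrizer V m (tens η) := by
  rw [symmetrizer_tens, symmetrizer_tens]
  congr 1
  exact Equiv.sum_comp (Equiv.mulLeft σ) fun τ => tens fun i => η (τ i)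

theorem symmetrizer_symmetrizer {m : ℕ} (x : HTensor V m) :
    symmetrizer V m (symmetrizer V m x) = symmetrizer V m x :=
  DFunLike.congr_fun (symmetrizer_idem m) x

/-- Permutations of `m + 1` slots are sorted by the index `p` that is moved to the front, which is
the factor contracted with `ξ`. The permutations of the remaining slots make up `P₊` on `m` factors,
and `1/(m+1)! = 1/(m+1) · 1/m!`. -/
theorem dOp_symmetrizer_tens {m : ℕ} (ξ : V) (η : Fin (m + 1) → V) :
    dOp m ξ (symmetrizer V (m + 1) (tens η)) = ((m : ℂ) + 1)⁻¹ • ∑ p, inner ℂ ξ (η p) •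
      symmetrizer V m (tens fun i : Fin m => η (Equiv.swap 0 p i.succ)) := by
  rw [symmetrizer_tens, map_smul, map_sum,
    ← Equiv.sum_comp (Equiv.Perm.decomposeFin (n := m)).symm, Fintype.sum_prod_type]
  simp only [dOp_tens, Equiv.Perm.decomposeFin_symm_apply_zero,
    Equiv.Perm.decomposeFin_symm_apply_succ, symmetrizer_tens, Finset.smul_sum, smul_smul]
  refine Finset.sum_congr rfl fun p _ => Finset.sum_congr rfl fun e _ => ?_
  congr 1
  rw [Nat.factorial_succ]
  push_cast
  rw [mul_inv]
  ring

/-- A permutation of the last `m` factors extends to one of all `m + 1` factors fixing the first,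
and the outer symmetrizer absorbs it. -/
theorem symmetrizer_cOp_symmetrizer {m : ℕ} (ξ : V) (x : HTensor V m) :
    symmetrizer V (m + 1) (cOp m ξ (symmetrizer V m x)) = symmetrizer V (m + 1) (cOp m ξ x) := by
  have h : symmetrizer V (m + 1) ∘L cOp m ξ ∘L symmetrizer V m =
      symmetrizer V (m + 1) ∘L cOp m ξ := by
    refine htensor_ext fun η => ?_
    simp only [ContinuousLinearMap.comp_apply, cOp_tens]
    rw [symmetrizer_tens η, map_smul, map_smul, map_sum, map_sum]
    have e : ∀ τ : Equiv.Perm (Fin m), symmetrizer V (m + 1) (cOp m ξ (tens fun i => η (τ i))) =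
        symmetrizer V (m + 1) (tens (Fin.cons ξ η : Fin (m + 1) → V)) := by
      intro τ
      rw [cOp_tens, ← symmetrizer_tens_perm (Equiv.Perm.decomposeFin.symm (0, τ))
        (Fin.cons ξ η : Fin (m + 1) → V)]
      congr 2
      funext i
      cases i using Fin.cases <;> simp
    rw [Finset.sum_congr rfl fun τ _ => e τ]
    simp [Fintype.card_perm, ← Nat.cast_smul_eq_nsmul ℂ, smul_smul, Nat.factorial_ne_zero]
  exact DFunLike.congr_fun h x

theorem symmetrizer_dOp_symmetrizer_cOp_zero (ξ : V) (x : HTensor V 0) :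
    symmetrizer V 0 (dOp 0 ξ (symmetrizer V 1 (cOp 0 ξ x))) =
      ((‖ξ‖ ^ 2 : ℝ) : ℂ) • symmetrizer V 0 x := by
  have h : symmetrizer V 0 ∘L dOp 0 ξ ∘L symmetrizer V 1 ∘L cOp 0 ξ =
      ((‖ξ‖ ^ 2 : ℝ) : ℂ) • symmetrizer V 0 := by
    refine htensor_ext fun η => ?_
    simp only [ContinuousLinearMap.comp_apply, cOp_tens, dOp_symmetrizer_tens, map_smul,
      smul_apply, Fin.sum_univ_succ]
    simp [symmetrizer_symmetrizer, inner_self_eq_norm_sq_to_K]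
  exact DFunLike.congr_fun h x

/-- The commutation relation on a sector with at least one particle. Contracting `ξ` with the
symmetrized `ξ ⊗ x` either hits the new factor, which gives `‖ξ‖²`, or hits a factor of `x`, which
gives the `a† a` term. The factors `m + 2` and `m + 1` are the squares of the roots in the
definitions of `a†` and `a`. -/
theorem symmetrizer_dOp_symmetrizer_cOp_succ (m : ℕ) (ξ : V) (x : HTensor V (m + 1)) :
    ((m : ℂ) + 2) • symmetrizer V (m + 1) (dOp (m + 1) ξ (symmetrizer V (m + 2)
        (cOp (m + 1) ξ x))) =
      ((‖ξ‖ ^ 2 : ℝ) : ℂ) • symmetrizer V (m + 1) x + ((m : ℂ) + 1) •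
        symmetrizer V (m + 1) (cOp m ξ (symmetrizer V m (dOp m ξ (symmetrizer V (m + 1) x)))) := by
  have h : ((m : ℂ) + 2) • symmetrizer V (m + 1) ∘L dOp (m + 1) ξ ∘L symmetrizer V (m + 2) ∘L
        cOp (m + 1) ξ =
      ((‖ξ‖ ^ 2 : ℝ) : ℂ) • symmetrizer V (m + 1) + ((m : ℂ) + 1) •
        symmetrizer V (m + 1) ∘L cOp m ξ ∘L symmetrizer V m ∘L dOp m ξ ∘L
          symmetrizer V (m + 1) := by
    refine htensor_ext fun η => ?_
    have h1 : (m : ℂ) + 1 ≠ 0 := Nat.cast_add_one_ne_zero m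
    have h2 : (m : ℂ) + 2 ≠ 0 := by exact_mod_cast (by lia : m + 2 ≠ 0)
    simp only [ContinuousLinearMap.comp_apply, add_apply,
      smul_apply, cOp_tens, dOp_symmetrizer_tens, map_smul, map_sum,
      symmetrizer_symmetrizer, symmetrizer_cOp_symmetrizer]
    rw [Fin.sum_univ_succ, smul_smul, smul_smul, mul_inv_cancel₀ h1, one_smul]
    push_cast
    rw [add_assoc, one_add_one_eq_two, mul_inv_cancel₀ h2, one_smul]
    congr 1
    · simp [inner_self_eq_norm_sq_to_K]
    · refine Finset.sum_congr rfl fun q _ => ?_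
      rw [Fin.cons_succ]
      congr 1
      -- On the left `ξ` occupies slot `q`, vacated by the contracted factor; the transposition
      -- brings it to the front, where it stands on the right.
      rw [← symmetrizer_tens_perm (Equiv.swap 0 q)]
      congr 2
      funext i
      rcases Fin.eq_zero_or_eq_succ i with rfl | ⟨i, rfl⟩
      · simp
      · rw [Fin.cons_succ]
        have hi : Equiv.swap 0 q i.succ ≠ q := by
          intro h
          have := congrArg (Equiv.swap 0 q) h
          rw [Equiv.swap_apply_self, Equiv.swap_apply_right] at this
          exact Fin.succ_ne_zero i this
        rw [Equiv.swap_apply_of_ne_of_ne (Fin.succ_ne_zero _) (fun h => hi (Fin.succ_injective _ h)),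
          Fin.cons_succ]
  exact DFunLike.congr_fun h x

theorem sqrt_mul_sqrt_complex (m : ℕ) :
    ((Real.sqrt (m + 1) : ℝ) : ℂ) * ((Real.sqrt (m + 1) : ℝ) : ℂ) = (m : ℂ) + 1 := by
  rw [← Complex.ofReal_mul, Real.mul_self_sqrt (by positivity)]
  push_cast
  rfl

/-- The canonical commutation relation `[a(ξ), a†(ξ)] = ‖ξ‖²`. -/
theorem annihilate_create (ξ : V) (ψ : finFock V) :
    annihilate ξ (create ξ ψ) = create ξ (annihilate ξ ψ) + ((‖ξ‖ ^ 2 : ℝ) : ℂ) • ψ := by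
  refine Subtype.ext (lp.ext (funext fun m => Subtype.ext ?_))
  rw [annihilate_apply, create_apply_succ, coe_annihilateSector, coe_createSector]
  have hψ : symmetrizer V m ((ψ : Fock V) m : HTensor V m) = (ψ : Fock V) m :=
    mem_symTensor.1 ((ψ : Fock V) m).2
  set x := ((ψ : Fock V) m : HTensor V m) with hx
  simp only [map_smul, smul_smul, sqrt_mul_sqrt_complex]
  change _ = ((create ξ (annihilate ξ ψ) : Fock V) m : HTensor V m) + ((‖ξ‖ ^ 2 : ℝ) : ℂ) • x
  cases m with
  | zero =>
    rw [create_apply_zero, symmetrizer_dOp_symmetrizer_cOp_zero, hψ]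
    simp
  | succ m =>
    rw [create_apply_succ, coe_createSector, annihilate_apply, coe_annihilateSector, ← hx]
    simp only [map_smul, smul_smul, sqrt_mul_sqrt_complex]
    have h := symmetrizer_dOp_symmetrizer_cOp_succ m ξ x
    rw [hψ] at h
    push_cast at h ⊢
    rw [add_assoc, one_add_one_eq_two, h]
    exact add_comm _ _

/-! ### Moments of the generator of the Weyl operators -/

/-- The moments `⟨φ, (a†(ξ) - a(ξ))ᵏ ψ⟩`. -/
noncomputable def moment (ξ : V) (φ ψ : finFock V) (k : ℕ) : ℂ :=
  inner ℂ (φ : Fock V) ((weylGen ξ ^ k) ψ : Fock V)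

theorem moment_zero (ξ : V) (φ ψ : finFock V) :
    moment ξ φ ψ 0 = inner ℂ (φ : Fock V) (ψ : Fock V) := rfl

theorem moment_zero_left (ξ : V) (ψ : finFock V) : moment ξ 0 ψ = 0 :=
  funext fun _ => inner_zero_left _

theorem moment_zero_right (ξ : V) (φ : finFock V) : moment ξ φ 0 = 0 := by
  funext k
  simp [moment]

theorem annihilate_weylGen (ξ : V) (ψ : finFock V) :
    annihilate ξ (weylGen ξ ψ) = weylGen ξ (annihilate ξ ψ) + ((‖ξ‖ ^ 2 : ℝ) : ℂ) • ψ := by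
  rw [weylGen, LinearMap.sub_apply, LinearMap.sub_apply, map_sub, annihilate_create]
  abel

/-- As the commutator with the generator is a scalar, commuting past a power acts like
differentiation. For `k = 0` the coefficient vanishes, so the truncated exponent `k - 1` is
harmless. -/
theorem annihilate_weylGen_pow (ξ : V) (k : ℕ) (ψ : finFock V) :
    annihilate ξ ((weylGen ξ ^ k) ψ) = (weylGen ξ ^ k) (annihilate ξ ψ) +
      (((‖ξ‖ ^ 2 : ℝ) : ℂ) * k) • (weylGen ξ ^ (k - 1)) ψ := by
  induction k with
  | zero => simp
  | succ k ih =>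
    rw [pow_succ', Module.End.mul_apply, Module.End.mul_apply, annihilate_weylGen, ih, map_add,
      map_smul, add_assoc, Nat.add_sub_cancel]
    congr 1
    cases k with
    | zero => simp
    | succ k =>
      rw [Nat.add_sub_cancel, ← Module.End.mul_apply, ← pow_succ', ← add_smul]
      congr 1
      push_cast
      ring

/-- The operator `(Mₖ) ↦ (Mₖ₊₁ + c k Mₖ₋₁)` on sequences; on exponential generating functions it is
`d/dt + c t`. -/
def heisenbergShift (c : ℂ) : (ℕ → ℂ) →ₗ[ℂ] (ℕ → ℂ) where
  toFun M k := M (k + 1) + c * k * M (k - 1)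
  map_add' M M' := by
    funext k
    simp only [Pi.add_apply]
    ring
  map_smul' r M := by
    funext k
    simp only [Pi.smul_apply, smul_eq_mul, RingHom.id_apply]
    ring

theorem heisenbergShift_apply (c : ℂ) (M : ℕ → ℂ) (k : ℕ) :
    heisenbergShift c M k = M (k + 1) + c * k * M (k - 1) := rfl

/-- In the outermost factor `a† - a` of the `(k+1)`-st power, `a†` moves to the left slot as its
adjoint, and `a` moves through the other `k` factors to reach `ψ`. The commutator terms produced on
the way are what the summand `c k Mₖ₋₁` cancels. -/
theorem heisenbergShift_moment (ξ : V) (φ ψ : finFock V) :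
    heisenbergShift ((‖ξ‖ ^ 2 : ℝ) : ℂ) (moment ξ φ ψ) =
      moment ξ (annihilate ξ φ) ψ - moment ξ φ (annihilate ξ ψ) := by
  funext k
  rw [heisenbergShift_apply, Pi.sub_apply]
  simp only [moment]
  rw [pow_succ', Module.End.mul_apply, coe_weylGen, inner_sub_right, ← inner_annihilate,
    annihilate_weylGen_pow, Submodule.coe_add, inner_add_right, Submodule.coe_smul,
    inner_smul_right]
  ring

/-- The recursion `Mₖ₊₁ = -c k Mₖ₋₁` has step two, but at `k = 0` it gives `M₁ = 0`, so `M₀` is the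
only free value. -/
theorem eq_of_heisenbergShift_eq_zero {c : ℂ} {M : ℕ → ℂ} (h : heisenbergShift c M = 0)
    (h0 : M 0 = 0) : M = 0 := by
  have key : ∀ k, M k = 0 ∧ M (k + 1) = 0 := by
    intro k
    induction k with
    | zero =>
      have h1 := congrFun h 0
      rw [heisenbergShift_apply] at h1
      simpa [h0] using h1
    | succ k ih =>
      refine ⟨ih.2, ?_⟩
      have h1 := congrFun h (k + 1)
      rw [heisenbergShift_apply, Nat.add_sub_cancel, ih.1] at h1
      simpa using h1
  exact funext fun k => (key k).1

/-- On vectors annihilated by `a(ξ)` the moments are determined by the norm. -/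
theorem moment_of_annihilate_eq_zero {ξ : V} {ψ φ : finFock V} (hψ : annihilate ξ ψ = 0)
    (hφ : annihilate ξ φ = 0) (h1 : inner ℂ (φ : Fock V) (φ : Fock V) = (1 : ℂ)) :
    moment ξ ψ ψ = inner ℂ (ψ : Fock V) (ψ : Fock V) • moment ξ φ φ := by
  rw [← sub_eq_zero]
  refine eq_of_heisenbergShift_eq_zero (c := ((‖ξ‖ ^ 2 : ℝ) : ℂ)) ?_ ?_
  · rw [map_sub, map_smul, heisenbergShift_moment, heisenbergShift_moment, hψ, hφ]
    simp only [moment_zero_left, moment_zero_right, sub_zero, smul_zero]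
  · rw [Pi.sub_apply, Pi.smul_apply, moment_zero, moment_zero, h1, smul_eq_mul, mul_one, sub_self]

theorem end_pow_succ_apply {E : Type*} [AddCommGroup E] [Module ℂ E] (f : E →ₗ[ℂ] E) (n : ℕ)
    (x : E) : (f ^ (n + 1)) x = (f ^ n) (f x) := by
  rw [pow_succ, Module.End.mul_apply]

/-- The shift acts as `a(ξ)` on the left slot minus `a(ξ)` on the right slot. These two actions
commute, so the `n`-th power expands binomially; with `a + b = n`, the vanishing of the next powers
leaves a single term. -/
theorem heisenbergShift_pow_moment (ξ : V) (n a b : ℕ) (hn : a + b = n) (φ ψ : finFock V)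
    (hφ : (annihilate ξ ^ (a + 1)) φ = 0) (hψ : (annihilate ξ ^ (b + 1)) ψ = 0) :
    (heisenbergShift ((‖ξ‖ ^ 2 : ℝ) : ℂ) ^ n) (moment ξ φ ψ) = ((-1 : ℂ) ^ b * (n.choose a : ℂ)) •
      moment ξ ((annihilate ξ ^ a) φ) ((annihilate ξ ^ b) ψ) := by
  induction n generalizing a b φ ψ with
  | zero =>
    obtain ⟨rfl, rfl⟩ : a = 0 ∧ b = 0 := by lia
    simp
  | succ n ih =>
    rw [pow_succ (heisenbergShift _), Module.End.mul_apply, heisenbergShift_moment, map_sub]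
    rcases a with _ | a
    · obtain rfl : b = n + 1 := by lia
      rw [end_pow_succ_apply] at hψ
      have hφ' : annihilate ξ φ = 0 := by simpa using hφ
      rw [hφ', moment_zero_left, map_zero, zero_sub,
        ih 0 n (by lia) φ (annihilate ξ ψ) hφ hψ]
      rw [← end_pow_succ_apply (annihilate ξ) n ψ, ← neg_smul]
      congr 1
      simp [pow_succ]
    rcases b with _ | b
    · obtain rfl : a = n := by lia
      rw [end_pow_succ_apply] at hφ
      have hψ' : annihilate ξ ψ = 0 := by simpa using hψ
      rw [hψ', moment_zero_right, map_zero, sub_zero,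
        ih a 0 (by lia) (annihilate ξ φ) ψ hφ hψ]
      rw [← end_pow_succ_apply (annihilate ξ) a φ]
      simp
    · have h1 : a + (b + 1) = n := by omega
      have h2 : a + 1 + b = n := by omega
      have hφ' := hφ
      have hψ' := hψ
      rw [end_pow_succ_apply] at hφ' hψ'
      -- Both terms lead to the same moment; the coefficients add up by Pascal's rule, the minus
      -- sign being absorbed into `(-1) ^ (b + 1)`.
      rw [ih a (b + 1) h1 (annihilate ξ φ) ψ hφ' hψ,
        ih (a + 1) b h2 φ (annihilate ξ ψ) hφ hψ']
      rw [← end_pow_succ_apply (annihilate ξ) a φ, ← end_pow_succ_apply (annihilate ξ) b ψ, ← sub_smul]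
      congr 1
      rw [Nat.choose_succ_succ]
      push_cast
      ring

/-- If the moments of `ψ` agree with those of a vector annihilated by `a(ξ)`, then
`a(ξ)ⁿ⁺² ψ = 0` implies `a(ξ)ⁿ⁺¹ ψ = 0`. -/
theorem annihilate_pow_eq_zero_of_moment_eq {ξ : V} {ψ φ : finFock V} (hφ : annihilate ξ φ = 0)
    (h : moment ξ ψ ψ = moment ξ φ φ) (n : ℕ) (hn : (annihilate ξ ^ (n + 2)) ψ = 0) :
    (annihilate ξ ^ (n + 1)) ψ = 0 := by
  have h1 := heisenbergShift_pow_moment ξ (n + 1 + (n + 1)) (n + 1) (n + 1) rfl ψ ψ hn hn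
  -- The exponent is positive, and one application already kills the moments of `φ`.
  have h2 : (heisenbergShift ((‖ξ‖ ^ 2 : ℝ) : ℂ) ^ (n + 1 + (n + 1))) (moment ξ φ φ) = 0 := by
    rw [← add_assoc, pow_succ (heisenbergShift _), Module.End.mul_apply, heisenbergShift_moment,
      hφ, moment_zero_left, moment_zero_right, sub_zero, map_zero]
  rw [h, h2] at h1
  have h3 := (smul_eq_zero.1 h1.symm).resolve_left (mul_ne_zero (pow_ne_zero _ (by norm_num))
    (Nat.cast_ne_zero.2 (Nat.choose_pos (by lia)).ne'))
  -- The zeroth moment is the squared norm of `a(ξ)ⁿ⁺¹ ψ`.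
  have h4 := congrFun h3 0
  rw [moment_zero] at h4
  exact Subtype.ext (inner_self_eq_zero.1 h4)

/-! ### Expectations of Weyl operators as series in the moments -/

theorem hasSum_inner_weyl (ξ : V) (φ ψ : finFock V) :
    HasSum (fun k => (k.factorial : ℂ)⁻¹ * moment ξ φ ψ k)
      (inner ℂ (φ : Fock V) (weyl ξ (ψ : Fock V))) := by
  rw [weyl_coe]
  have h := (innerSL ℂ (φ : Fock V)).hasSum (summable_weylTerm ξ ψ).hasSum
  refine h.congr_fun fun k => ?_
  rw [innerSL_apply_apply, weylTerm, inner_smul_right, moment]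

/-- The vacuum as a finite-particle vector. -/
noncomputable def finVacuum (V : Type*) [NormedAddCommGroup V] [InnerProductSpace ℂ V] :
    finFock V :=
  finSingle 0 ⟨tens (Fin.elim0 : Fin 0 → V), tens_mem_symTensor_zero⟩

theorem coe_finVacuum : (finVacuum V : Fock V) = vacuum V := rfl

theorem annihilate_finVacuum (ξ : V) : annihilate ξ (finVacuum V) = 0 :=
  annihilate_finSingle_zero ξ _

theorem norm_vacuum : ‖vacuum V‖ = 1 := by
  rw [vacuum, lp.norm_single (by norm_num)]
  have h := inner_tens_tens (Fin.elim0 : Fin 0 → V) Fin.elim0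
  rw [inner_self_eq_norm_sq_to_K, Fin.prod_univ_zero] at h
  have h2 : ‖tens (Fin.elim0 : Fin 0 → V)‖ ^ 2 = 1 := by
    apply Complex.ofReal_injective
    simpa using h
  exact (pow_eq_one_iff_of_nonneg (norm_nonneg _) two_ne_zero).1 h2

theorem inner_vacuum_self : inner ℂ (vacuum V) (vacuum V) = (1 : ℂ) := by
  rw [inner_self_eq_norm_sq_to_K, norm_vacuum]
  simp

theorem inner_weyl_of_annihilate_eq_zero {ξ : V} {ψ : finFock V} (hψ : annihilate ξ ψ = 0) :
    inner ℂ (ψ : Fock V) (weyl ξ (ψ : Fock V)) =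
      inner ℂ (ψ : Fock V) (ψ : Fock V) * inner ℂ (vacuum V) (weyl ξ (vacuum V)) := by
  refine (hasSum_inner_weyl ξ ψ ψ).unique ?_
  have h := (hasSum_inner_weyl ξ (finVacuum V) (finVacuum V)).mul_left
    (inner ℂ (ψ : Fock V) (ψ : Fock V))
  refine h.congr_fun fun k => ?_
  rw [moment_of_annihilate_eq_zero hψ (annihilate_finVacuum ξ) inner_vacuum_self, Pi.smul_apply,
    smul_eq_mul]
  ring

/-! ### Dependence on a real parameter -/

theorem cOp_smul (m : ℕ) (c : ℂ) (ξ : V) : cOp m (c • ξ) = c • cOp m ξ := by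
  refine htensor_ext fun η => ?_
  rw [smul_apply, cOp_tens, cOp_tens, tens, tens, ← map_smul]
  congr 1
  exact (tmul (m + 1)).cons_smul η c ξ

theorem dOp_smul (m : ℕ) (c : ℂ) (ξ : V) : dOp m (c • ξ) = starRingEnd ℂ c • dOp m ξ := by
  rw [dOp, cOp_smul, map_smulₛₗ, ← dOp]

theorem createSector_smul (m : ℕ) (c : ℂ) (ξ : V) (x : SymTensor V m) :
    createSector m (c • ξ) x = c • createSector m ξ x := by
  refine Subtype.ext ?_
  rw [Submodule.coe_smul, coe_createSector, coe_createSector, cOp_smul, smul_apply, smul_comm,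
    map_smul]

theorem annihilateSector_smul (m : ℕ) (c : ℂ) (ξ : V) (x : SymTensor V (m + 1)) :
    annihilateSector m (c • ξ) x = starRingEnd ℂ c • annihilateSector m ξ x := by
  refine Subtype.ext ?_
  rw [Submodule.coe_smul, coe_annihilateSector, coe_annihilateSector, dOp_smul,
    smul_apply, smul_comm, map_smul]

theorem weylGen_smul (t : ℝ) (ξ : V) : weylGen ((t : ℂ) • ξ) = (t : ℂ) • weylGen ξ := by
  refine LinearMap.ext fun ψ => ?_
  have h1 : create ((t : ℂ) • ξ) ψ = (t : ℂ) • create ξ ψ := by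
    refine Subtype.ext (lp.ext (funext fun m => ?_))
    cases m with
    | zero => exact (smul_zero (t : ℂ)).symm
    | succ m => exact createSector_smul m t ξ _
  have h2 : annihilate ((t : ℂ) • ξ) ψ = (t : ℂ) • annihilate ξ ψ :=
    Subtype.ext (lp.ext (funext fun m => by
      have h := annihilateSector_smul m t ξ ((ψ : Fock V) (m + 1))
      rw [Complex.conj_ofReal] at h
      exact h))
  rw [weylGen, LinearMap.sub_apply, h1, h2, ← smul_sub]
  rfl

theorem moment_smul (t : ℝ) (ξ : V) (φ ψ : finFock V) (k : ℕ) :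
    moment ((t : ℂ) • ξ) φ ψ k = (t : ℂ) ^ k * moment ξ φ ψ k := by
  rw [moment, weylGen_smul, smul_pow, LinearMap.smul_apply, Submodule.coe_smul, inner_smul_right,
    moment]

/-- Uniqueness of the power series expansion at `0`, for a function of a real variable with complex
values: only real multiples of `ξ` are available in `W`. -/
theorem eq_of_hasSum_real_pow {a b : ℕ → ℂ} {f : ℝ → ℂ}
    (ha : ∀ t : ℝ, HasSum (fun k => (t : ℂ) ^ k * a k) (f t))
    (hb : ∀ t : ℝ, HasSum (fun k => (t : ℂ) ^ k * b k) (f t)) : a = b := by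
  let p (c : ℕ → ℂ) : FormalMultilinearSeries ℝ ℝ ℂ := fun n =>
    ContinuousMultilinearMap.mkPiRing ℝ (Fin n) (c n)
  have key : ∀ c : ℕ → ℂ, (∀ t : ℝ, HasSum (fun k => (t : ℂ) ^ k * c k) (f t)) →
      HasFPowerSeriesAt f (p c) 0 := by
    intro c hc
    rw [hasFPowerSeriesAt_iff]
    refine Filter.Eventually.of_forall fun t => ?_
    rw [zero_add]
    refine (hc t).congr_fun fun k => ?_
    simp [FormalMultilinearSeries.coeff, p]
  have h := (key a ha).eq_formalMultilinearSeries (key b hb)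
  funext n
  have h2 := congrArg (fun p => FormalMultilinearSeries.coeff p n) h
  simpa [FormalMultilinearSeries.coeff, p] using h2

/-- Equality of the expectations of all `W(tξ)` implies equality of the moments. -/
theorem moment_eq_of_inner_weyl_eq {ξ : V} {ψ φ : finFock V}
    (h : ∀ t : ℝ, inner ℂ (ψ : Fock V) (weyl ((t : ℂ) • ξ) (ψ : Fock V)) =
      inner ℂ (φ : Fock V) (weyl ((t : ℂ) • ξ) (φ : Fock V))) :
    moment ξ ψ ψ = moment ξ φ φ := by
  have key : ∀ χ : finFock V, ∀ t : ℝ,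
      HasSum (fun k => (t : ℂ) ^ k * ((k.factorial : ℂ)⁻¹ * moment ξ χ χ k))
        (inner ℂ (χ : Fock V) (weyl ((t : ℂ) • ξ) (χ : Fock V))) := by
    intro χ t
    refine (hasSum_inner_weyl ((t : ℂ) • ξ) χ χ).congr_fun fun k => ?_
    rw [moment_smul]
    ring
  have h1 := eq_of_hasSum_real_pow (key ψ) (fun t => (h t) ▸ key φ t)
  funext k
  exact mul_left_cancel₀ (inv_ne_zero (Nat.cast_ne_zero.2 k.factorial_ne_zero)) (congrFun h1 k)

/-! ### Vanishing of symmetric multilinear forms -/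

/-- The inclusion-exclusion identity behind polarization. The sum factors over `i` into `1 - 0 ^
|φ⁻¹(i)|`, which is `1` if the fibre is nonempty and `0` otherwise. -/
theorem sum_bool_prod_eq_ite_surjective {n : ℕ} (φ : Fin n → Fin n) :
    ∑ ε : Fin n → Bool, (∏ i, (if ε i then (1 : ℂ) else -1)) *
      ∏ j, (if ε (φ j) then (1 : ℂ) else 0) = if Function.Surjective φ then 1 else 0 := by
  have h : ∀ ε : Fin n → Bool, (∏ i, (if ε i then (1 : ℂ) else -1)) *
      ∏ j, (if ε (φ j) then (1 : ℂ) else 0) = ∏ i, ((if ε i then (1 : ℂ) else -1) *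
        (if ε i then (1 : ℂ) else 0) ^ (Finset.univ.filter fun j => φ j = i).card) := by
    intro ε
    rw [Finset.prod_mul_distrib, ← Finset.prod_fiberwise' Finset.univ φ
      (fun i => if ε i then (1 : ℂ) else 0)]
    simp only [Finset.prod_const]
  rw [Finset.sum_congr rfl fun ε _ => h ε, ← Fintype.prod_sum (fun (i : Fin n) (b : Bool) =>
    (if b then (1 : ℂ) else -1) *
      (if b then (1 : ℂ) else 0) ^ (Finset.univ.filter fun j => φ j = i).card)]
  simp only [Fintype.sum_bool, if_true, Bool.false_eq_true, if_false, one_pow, one_mul]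
  split_ifs with hφ
  · refine Finset.prod_eq_one fun i _ => ?_
    obtain ⟨j, hj⟩ := hφ i
    rw [zero_pow (Finset.card_pos.2 ⟨j, by simpa using hj⟩).ne']
    simp
  · obtain ⟨i, hi⟩ := not_forall.1 hφ
    refine Finset.prod_eq_zero (Finset.mem_univ i) ?_
    rw [Finset.filter_eq_empty_iff.2 fun j _ hj => hi ⟨j, hj⟩]
    simp

/-- Polarization: a symmetric multilinear form that vanishes on the diagonal of a real subspace
vanishes on this subspace. -/
theorem multilinear_eq_zero_of_diagonal {n : ℕ} (f : MultilinearMap ℂ (fun _ : Fin n => V) ℂ)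
    (W : Submodule ℝ V) (hsymm : ∀ (σ : Equiv.Perm (Fin n)) ξ, f (fun i => ξ (σ i)) = f ξ)
    (hdiag : ∀ ξ ∈ W, f (fun _ => ξ) = 0) (ξ : Fin n → V) (hξ : ∀ i, ξ i ∈ W) : f ξ = 0 := by
  -- The signed sum of the diagonal values at all partial sums of the `ξ i`. Each partial sum lies
  -- in `W`, as the coefficients are only `0` and `1`.
  have h0 : ∑ ε : Fin n → Bool, (∏ i, (if ε i then (1 : ℂ) else -1)) *
      f (fun _ => ∑ i, (if ε i then (1 : ℂ) else 0) • ξ i) = 0 := by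
    refine Finset.sum_eq_zero fun ε _ => ?_
    rw [hdiag _ (W.sum_mem fun i _ => ?_), mul_zero]
    split_ifs
    · rw [one_smul]; exact hξ i
    · rw [zero_smul]; exact W.zero_mem
  have h1 : ∀ ε : Fin n → Bool, f (fun _ => ∑ i, (if ε i then (1 : ℂ) else 0) • ξ i) =
      ∑ φ : Fin n → Fin n, (∏ j, (if ε (φ j) then (1 : ℂ) else 0)) * f (fun j => ξ (φ j)) := by
    intro ε
    rw [MultilinearMap.map_sum]
    refine Finset.sum_congr rfl fun φ _ => ?_
    rw [MultilinearMap.map_smul_univ, smul_eq_mul]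
  simp only [h1, Finset.mul_sum, ← mul_assoc] at h0
  rw [Finset.sum_comm] at h0
  simp only [← Finset.sum_mul, sum_bool_prod_eq_ite_surjective] at h0
  have h2 : ∀ φ : Fin n → Fin n, (if Function.Surjective φ then (1 : ℂ) else 0) *
      f (fun j => ξ (φ j)) = (if Function.Surjective φ then (1 : ℂ) else 0) * f ξ := by
    intro φ
    split_ifs with hφ
    · rw [← hsymm (Equiv.ofBijective φ (Finite.surjective_iff_bijective.1 hφ)) ξ]
      rfl
    · rw [zero_mul, zero_mul]
  rw [Finset.sum_congr rfl fun φ _ => h2 φ, ← Finset.sum_mul, Finset.sum_boole] at h0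
  -- What remains is `f ξ` times the number of surjective self-maps, which is positive because the
  -- identity is one of them.
  refine (mul_eq_zero.1 h0).resolve_left (Nat.cast_ne_zero.2 (Finset.card_pos.2 ⟨id, ?_⟩).ne')
  simpa using Function.surjective_id

/-- A separately continuous multilinear form that vanishes on a set with dense linear span is
zero. -/
theorem multilinear_eq_zero_of_dense {n : ℕ} (f : MultilinearMap ℂ (fun _ : Fin n => V) ℂ)
    (hf : ∀ ξ i, Continuous (f.toLinearMap ξ i)) (W : Set V)
    (hW : Dense (Submodule.span ℂ W : Set V)) (h : ∀ ξ : Fin n → V, (∀ i, ξ i ∈ W) → f ξ = 0)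
    (ξ : Fin n → V) : f ξ = 0 := by
  -- The slots are freed from `W` one at a time: `s` collects those whose entries are already
  -- arbitrary.
  have key : ∀ s : Finset (Fin n), ∀ ξ : Fin n → V, (∀ i, i ∉ s → ξ i ∈ W) → f ξ = 0 := by
    intro s
    induction s using Finset.induction_on with
    | empty => exact fun ξ hξ => h ξ fun i => hξ i (Finset.notMem_empty i)
    | insert a s ha ih =>
      intro ξ hξ
      have h1 : ∀ x ∈ W, f.toLinearMap ξ a x = 0 := by
        intro x hx
        refine ih (Function.update ξ a x) fun i hi => ?_
        by_cases hia : i = a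
        · subst hia; simpa using hx
        · rw [Function.update_of_ne hia]
          exact hξ i (by simp [hia, hi])
      have h2 : Submodule.span ℂ W ≤ LinearMap.ker (f.toLinearMap ξ a) := Submodule.span_le.2 h1
      have h3 : (f.toLinearMap ξ a : V → ℂ) = fun _ => 0 :=
        Continuous.ext_on hW (hf ξ a) continuous_const fun x hx => h2 hx
      have h4 := congrFun h3 (ξ a)
      rwa [MultilinearMap.toLinearMap_apply, Function.update_eq_self] at h4
  exact key Finset.univ ξ fun i hi => absurd (Finset.mem_univ i) hi

theorem norm_tens {m : ℕ} (ξ : Fin m → V) : ‖tens ξ‖ = ∏ i, ‖ξ i‖ := by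
  have h := inner_tens_tens ξ ξ
  simp only [inner_self_eq_norm_sq_to_K, Finset.prod_pow] at h
  have h2 : ‖tens ξ‖ ^ 2 = (∏ i, ‖ξ i‖) ^ 2 := by
    apply Complex.ofReal_injective
    push_cast
    exact h
  exact (pow_left_inj₀ (norm_nonneg _) (Finset.prod_nonneg fun _ _ => norm_nonneg _)
    two_ne_zero).1 h2

/-- The multilinear form `ξ ↦ ⟨x, ξ₁ ⊗ ⋯ ⊗ ξₘ⟩`. -/
noncomputable def innerTens {m : ℕ} (x : HTensor V m) :
    MultilinearMap ℂ (fun _ : Fin m => V) ℂ :=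
  ((innerSL ℂ x ∘L toHTensor m : TensorPow V m →L[ℂ] ℂ) :
    TensorPow V m →ₗ[ℂ] ℂ).compMultilinearMap (tmul m)

theorem innerTens_apply {m : ℕ} (x : HTensor V m) (ξ : Fin m → V) :
    innerTens x ξ = inner ℂ x (tens ξ) := rfl

theorem continuous_innerTens {m : ℕ} (x : HTensor V m) (ξ : Fin m → V) (i : Fin m) :
    Continuous ((innerTens x).toLinearMap ξ i) := by
  refine AddMonoidHomClass.continuous_of_bound _
    (‖x‖ * ∏ j ∈ Finset.univ.erase i, ‖ξ j‖) fun v => ?_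
  rw [MultilinearMap.toLinearMap_apply, innerTens_apply]
  refine (norm_inner_le_norm _ _).trans (le_of_eq ?_)
  rw [norm_tens, ← Finset.mul_prod_erase _ _ (Finset.mem_univ i), Function.update_self,
    Finset.prod_congr rfl fun j hj => by
      rw [Function.update_of_ne (Finset.ne_of_mem_erase hj)]]
  ring

/-- A symmetric tensor orthogonal to all `ξ ⊗ ⋯ ⊗ ξ`, `ξ ∈ W`, vanishes if the complex span of the
real subspace `W` is dense. -/
theorem symTensor_eq_zero {m : ℕ} (W : Submodule ℝ V)
    (hW : Dense (Submodule.span ℂ (W : Set V) : Set V)) (x : SymTensor V m)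
    (hx : ∀ ξ ∈ W, inner ℂ (x : HTensor V m) (tens fun _ : Fin m => ξ) = (0 : ℂ)) : x = 0 := by
  have hsymm : ∀ (σ : Equiv.Perm (Fin m)) ξ,
      innerTens (x : HTensor V m) (fun i => ξ (σ i)) = innerTens (x : HTensor V m) ξ := by
    intro σ ξ
    rw [innerTens_apply, innerTens_apply, ← mem_symTensor.1 x.2, symmetrizer_inner,
      symmetrizer_tens_perm, ← symmetrizer_inner]
  have h := multilinear_eq_zero_of_dense _ (continuous_innerTens (x : HTensor V m)) W hW
    (multilinear_eq_zero_of_diagonal _ W hsymm hx)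
  have h2 : innerSL ℂ (x : HTensor V m) = 0 := htensor_ext fun ξ => h ξ
  exact Subtype.ext (inner_self_eq_zero.1 (DFunLike.congr_fun h2 (x : HTensor V m)))

/-! ### Powers of the annihilation operator -/

theorem annihilate_pow_eq_zero (ξ : V) (n : ℕ) (ψ : finFock V)
    (hψ : ∀ m, n ≤ m → (ψ : Fock V) m = 0) : (annihilate ξ ^ n) ψ = 0 := by
  induction n generalizing ψ with
  | zero => exact Subtype.ext (lp.ext (funext fun m => hψ m (Nat.zero_le m)))
  | succ n ih =>
    rw [end_pow_succ_apply]
    refine ih _ fun m hm => ?_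
    rw [annihilate_apply, hψ (m + 1) (by omega), map_zero]

theorem inner_create_pow (ξ : V) (n : ℕ) (ψ φ : finFock V) :
    inner ℂ ((create ξ ^ n) ψ : Fock V) (φ : Fock V) =
      inner ℂ (ψ : Fock V) ((annihilate ξ ^ n) φ : Fock V) := by
  induction n generalizing ψ with
  | zero => rfl
  | succ n ih =>
    rw [end_pow_succ_apply, ih, inner_create, pow_succ', Module.End.mul_apply]

/-- The tensor `ξ ⊗ ⋯ ⊗ ξ` is already symmetric, so the symmetrizers do nothing and only the roots
accumulate, to `r = √(n!)`. Only `r ≠ 0` matters later. -/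
theorem create_pow_finVacuum (ξ : V) (n : ℕ) : ∃ (y : SymTensor V n) (r : ℂ), r ≠ 0 ∧
    (y : HTensor V n) = r • tens (fun _ : Fin n => ξ) ∧
      (create ξ ^ n) (finVacuum V) = finSingle n y := by
  induction n with
  | zero =>
    refine ⟨_, 1, one_ne_zero, ?_, rfl⟩
    rw [one_smul]
    exact congrArg tens (Subsingleton.elim (Fin.elim0 : Fin 0 → V) fun _ => ξ)
  | succ n ih =>
    obtain ⟨y, r, hr, hy, h⟩ := ih
    refine ⟨createSector n ξ y, ((Real.sqrt (n + 1) : ℝ) : ℂ) * r, mul_ne_zero ?_ hr, ?_, ?_⟩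
    · exact Complex.ofReal_ne_zero.2 (Real.sqrt_pos.2 (by positivity)).ne'
    · have hc : (Fin.cons ξ (fun _ : Fin n => ξ) : Fin (n + 1) → V) = fun _ => ξ := by
        funext i
        cases i using Fin.cases <;> simp
      have hs : symmetrizer V (n + 1) (tens fun _ : Fin (n + 1) => ξ) = tens fun _ => ξ := by
        simp [symmetrizer_tens, Fintype.card_perm, ← Nat.cast_smul_eq_nsmul ℂ, smul_smul,
          Nat.factorial_ne_zero]
      rw [coe_createSector, hy, map_smul, map_smul, map_smul, cOp_tens, hc, hs, smul_smul]
    · rw [pow_succ', Module.End.mul_apply, h, create_finSingle]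

theorem inner_tens_eq_zero_of_annihilate_pow (ξ : V) (n : ℕ) (ψ : finFock V)
    (h : (annihilate ξ ^ n) ψ = 0) :
    inner ℂ ((ψ : Fock V) n : HTensor V n) (tens fun _ : Fin n => ξ) = (0 : ℂ) := by
  obtain ⟨y, r, hr, hy, hc⟩ := create_pow_finVacuum ξ n
  have h1 := inner_create_pow ξ n (finVacuum V) ψ
  rw [h, hc] at h1
  have h2 : inner ℂ (finSingle n y : Fock V) (ψ : Fock V) = inner ℂ y ((ψ : Fock V) n) :=
    lp.inner_single_left (G := fun m : ℕ => SymTensor V m) n y (ψ : Fock V)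
  rw [h2, Submodule.coe_inner, hy, inner_smul_left, Submodule.coe_zero, inner_zero_right] at h1
  have h3 := (mul_eq_zero.1 h1).resolve_left (by simpa using hr)
  exact inner_eq_zero_symm.1 h3

/-- Induction on a bound `N` for the particle number: the top component is removed as long as it
lies above the vacuum sector. -/
theorem finFock_apply_eq_zero_of_moment_eq (W : Submodule ℝ V)
    (hW : Dense (Submodule.span ℂ (W : Set V) : Set V)) (ψ : finFock V)
    (h : ∀ ξ ∈ W, moment ξ ψ ψ = moment ξ (finVacuum V) (finVacuum V)) (m : ℕ) (hm : 0 < m) :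
    (ψ : Fock V) m = 0 := by
  have key : ∀ N : ℕ, (∀ m, N < m → (ψ : Fock V) m = 0) → ∀ m, 0 < m → (ψ : Fock V) m = 0 := by
    intro N
    induction N with
    | zero => exact id
    | succ N ih =>
      intro hN
      refine ih fun m hm => ?_
      rcases (Nat.succ_le_of_lt hm).eq_or_lt with rfl | hm'
      · refine symTensor_eq_zero W hW _ fun ξ hξ =>
          inner_tens_eq_zero_of_annihilate_pow ξ (N + 1) ψ ?_
        -- At most `N + 1` particles give `a(ξ)ᴺ⁺² ψ = 0` for free; equality of moments lowers the
        -- exponent by one, which is what reaches the component `N + 1`.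
        exact annihilate_pow_eq_zero_of_moment_eq (annihilate_finVacuum ξ) (h ξ hξ) N
          (annihilate_pow_eq_zero ξ _ ψ fun m hm => hN m (by omega))
      · exact hN m hm'
  obtain ⟨N, hN⟩ := ψ.2
  exact key N hN m hm

theorem htensor_zero_eq_smul (x : HTensor V 0) :
    x = inner ℂ (tens (Fin.elim0 : Fin 0 → V)) x • tens (Fin.elim0 : Fin 0 → V) := by
  have h : ContinuousLinearMap.id ℂ (HTensor V 0) =
      (innerSL ℂ (tens (Fin.elim0 : Fin 0 → V))).smulRight (tens (Fin.elim0 : Fin 0 → V)) := by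
    refine htensor_ext fun ξ => ?_
    obtain rfl : ξ = Fin.elim0 := Subsingleton.elim _ _
    rw [ContinuousLinearMap.smulRight_apply, innerSL_apply_apply, inner_tens_tens]
    simp
  exact DFunLike.congr_fun h x

theorem eq_smul_vacuum (ψ : Fock V) (h : ∀ m, 0 < m → ψ m = 0) : ∃ c : ℂ, ψ = c • vacuum V := by
  refine ⟨inner ℂ (tens (Fin.elim0 : Fin 0 → V)) (ψ 0 : HTensor V 0), lp.ext (funext fun m => ?_)⟩
  rw [lp.coeFn_smul, Pi.smul_apply]
  cases m with
  | zero =>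
    refine Subtype.ext ?_
    rw [← coe_finVacuum, finVacuum, finSingle_self]
    exact htensor_zero_eq_smul _
  | succ m =>
    rw [h _ m.succ_pos, ← coe_finVacuum, finVacuum, finSingle_ne m.succ_ne_zero, smul_zero]

/-! ### Vectors over the orthogonal complement -/

/-- Every contraction of `ξ` with a factor from `U` vanishes; kernels of bounded operators are
closed, so this passes to the closed span. -/
theorem dOp_symmetrizer_eq_zero {m : ℕ} {ξ : V} {U : Submodule ℂ V}
    (hU : ∀ u ∈ U, inner ℂ ξ u = (0 : ℂ)) {x : HTensor V (m + 1)} (hx : x ∈ tensorOver U (m + 1)) :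
    dOp m ξ (symmetrizer V (m + 1) x) = 0 := by
  have h : tensorOver U (m + 1) ≤
      (dOp m ξ ∘L symmetrizer V (m + 1) : HTensor V (m + 1) →L[ℂ] HTensor V m).ker := by
    refine Submodule.topologicalClosure_minimal _ (Submodule.span_le.2 ?_)
      (ContinuousLinearMap.isClosed_ker _)
    rintro _ ⟨u, hu, rfl⟩
    change dOp m ξ (symmetrizer V (m + 1) (tens u)) = 0
    rw [dOp_symmetrizer_tens, Finset.sum_eq_zero fun p _ => by rw [hU _ (hu p), zero_smul],
      smul_zero]
  exact h hx

theorem annihilate_finSingle_eq_zero {ξ : V} {U : Submodule ℂ V}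
    (hU : ∀ u ∈ U, inner ℂ ξ u = (0 : ℂ)) {ψ : Fock V} (hψ : ψ ∈ fockOver U) (n : ℕ) :
    annihilate ξ (finSingle n (ψ n)) = 0 := by
  cases n with
  | zero => exact annihilate_finSingle_zero ξ _
  | succ n =>
    have h : annihilateSector n ξ (ψ (n + 1)) = 0 := by
      obtain ⟨x, hx, hx'⟩ := hψ (n + 1)
      refine Subtype.ext ?_
      rw [coe_annihilateSector, ← hx']
      change symmetrizer V n (_ • dOp n ξ (symmetrizer V (n + 1) x)) = 0
      rw [dOp_symmetrizer_eq_zero hU hx, smul_zero, map_zero]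
    rw [annihilate_finSingle_succ, h]
    refine Subtype.ext (lp.ext (funext fun m => ?_))
    by_cases hm : m = n
    · subst hm
      exact finSingle_self _ _
    · exact finSingle_ne hm _

/-- The moments make sense only for finite-particle vectors, so `ψ` is approximated by its finite
partial sums. Each of them is annihilated by `a(ξ)`, and both sides are continuous in the vector. -/
theorem inner_weyl_of_mem_fockOver {ξ : V} {U : Submodule ℂ V}
    (hU : ∀ u ∈ U, inner ℂ ξ u = (0 : ℂ)) {ψ : Fock V} (hψ : ψ ∈ fockOver U) :
    inner ℂ ψ (weyl ξ ψ) = inner ℂ ψ ψ * inner ℂ (vacuum V) (weyl ξ (vacuum V)) := by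
  let S : Finset ℕ → finFock V := fun s => ∑ n ∈ s, finSingle n (ψ n)
  have hS : Filter.Tendsto (fun s => (S s : Fock V)) Filter.atTop (nhds ψ) := by
    have h := lp.hasSum_single (E := fun m => SymTensor V m) (p := 2) (by norm_num) ψ
    refine Filter.Tendsto.congr (fun s => ?_) h
    rw [Submodule.coe_sum]
    rfl
  have hS0 : ∀ s, annihilate ξ (S s) = 0 := fun s => by
    rw [map_sum]
    exact Finset.sum_eq_zero fun n _ => annihilate_finSingle_eq_zero hU hψ n
  have h1 : Filter.Tendsto (fun s => inner ℂ (S s : Fock V) (weyl ξ (S s : Fock V))) Filter.atTop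
      (nhds (inner ℂ ψ (weyl ξ ψ))) := hS.inner (((weyl ξ).continuous.tendsto ψ).comp hS)
  have h2 : Filter.Tendsto (fun s => inner ℂ (S s : Fock V) (S s : Fock V) *
      inner ℂ (vacuum V) (weyl ξ (vacuum V))) Filter.atTop
      (nhds (inner ℂ ψ ψ * inner ℂ (vacuum V) (weyl ξ (vacuum V)))) :=
    (hS.inner hS).mul_const _
  exact tendsto_nhds_unique (h1.congr fun s => inner_weyl_of_annihilate_eq_zero (hS0 s)) h2

end
end FockSpace

/-! ### Proof of the two statements -/

theorem mainTheorem2 {V : Type*} [NormedAddCommGroup V] [InnerProductSpace ℂ V] [CompleteSpace V]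
    (W : Submodule ℝ V) :
    (∀ ψ : FockSpace.Fock V,
      ψ ∈ FockSpace.fockOver (Submodule.span ℂ (W : Set V)).topologicalClosureᗮ → ‖ψ‖ = 1 →
        ∀ ξ ∈ W, inner ℂ ψ (FockSpace.weyl ξ ψ) =
          inner ℂ (FockSpace.vacuum V) (FockSpace.weyl ξ (FockSpace.vacuum V))) ∧
    (Dense (Submodule.span ℂ (W : Set V) : Set V) →
      ∀ ψ : FockSpace.Fock V, ψ ∈ FockSpace.finFock V →
        ((∀ ξ ∈ W, inner ℂ ψ (FockSpace.weyl ξ ψ) =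
            inner ℂ (FockSpace.vacuum V) (FockSpace.weyl ξ (FockSpace.vacuum V))) ↔
          ∃ c : ℂ, ‖c‖ = 1 ∧ ψ = c • FockSpace.vacuum V)) := by
  refine ⟨fun ψ hψ hn ξ hξ => ?_, fun hW ψ hψ => ⟨fun h => ?_, ?_⟩⟩
  · rw [FockSpace.inner_weyl_of_mem_fockOver (fun u hu => ?_) hψ, inner_self_eq_norm_sq_to_K, hn]
    · simp
    · exact (Submodule.mem_orthogonal _ _).1 hu ξ
        (Submodule.le_topologicalClosure _ (Submodule.subset_span hξ))
  · have hM : ∀ ξ ∈ W, FockSpace.moment ξ ⟨ψ, hψ⟩ ⟨ψ, hψ⟩ =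
        FockSpace.moment ξ (FockSpace.finVacuum V) (FockSpace.finVacuum V) := fun ξ hξ =>
      FockSpace.moment_eq_of_inner_weyl_eq fun t => h _ (by
        rw [Complex.coe_smul]
        exact W.smul_mem t hξ)
    obtain ⟨c, hc⟩ := FockSpace.eq_smul_vacuum ψ
      (FockSpace.finFock_apply_eq_zero_of_moment_eq W hW ⟨ψ, hψ⟩ hM)
    refine ⟨c, ?_, hc⟩
    -- Normalization is part of the conclusion: it is the equality of zeroth moments, taken at `ξ =
    -- 0`, which always lies in `W`.
    have h0 : inner ℂ ψ ψ = inner ℂ (FockSpace.vacuum V) (FockSpace.vacuum V) :=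
      congrFun (hM 0 W.zero_mem) 0
    rw [FockSpace.inner_vacuum_self, inner_self_eq_norm_sq_to_K] at h0
    have h1 : ‖ψ‖ ^ 2 = 1 := by
      apply Complex.ofReal_injective
      simpa using h0
    rw [pow_eq_one_iff_of_nonneg (norm_nonneg _) two_ne_zero, hc, norm_smul,
      FockSpace.norm_vacuum, mul_one] at h1
    exact h1
  · rintro ⟨c, hc, rfl⟩ ξ -
    rw [map_smul, inner_smul_left, inner_smul_right, ← mul_assoc, RCLike.conj_mul, hc]
    simp
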